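/- Let $(R,\mathfrak m)$ be a complete discrete valuation ring with finite residue field $R/\mathfrak m=\mathbb F_q$. Let $r\ge 1$ and let $P_1(t),\dots,P_r(t)\in R[t]$ be monic polynomials whose reductions modulo $\mathfrak m$ are distinct irreducible polynomials $\overline P_1(t),\dots,\overline P_r(t)\in\mathbb F_q[t]$, and suppose that $\deg(P_r)=1$. For a matrix $M\in \mathrm{Mat}_n(R)$ write $\mathrm{coker}(M)=R^n/MR^n$, and let $\mathrm{Prob}_{A\in\mathrm{Mat}_n(R)}$ denote the Haar probability measure on the compact additive group $\mathrm{Mat}_n(R)$, where $R$ carries the $\mathfrak m$-adic topology. Then for every $R$-module $H$ of finite length the group $\mathrm{Aut}_R(H)$ is finite, the infinite products below converge unconditionally, the events below are Borel measurable for every $n$, and $$\lim_{n\to\infty}\mathrm{Prob}_{A\in\mathrm{Mat}_n(R)}\left(\begin{array}{c}\mathrm{coker}(P_1(A))=\cdots=\mathrm{coker}(P_{r-1}(A))=0\\ \text{and } \mathrm{coker}(P_r(A))\simeq H\end{array}\right)=\frac{1}{|\mathrm{Aut}_R(H)|}\prod_{j=1}^{r}\prod_{i=1}^{\infty}\left(1-q^{-i\deg(P_j)}\right),$$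 where $\simeq$ denotes isomorphism of $R$-modules. -/

import Mathlib

open Filter Topology MeasureTheory Polynomial
open IsLocalRing (maximalIdeal ResidueField residue)

/-- A Noetherian ring that is complete and separated for the `I`-adic topology, with `R ⧸ I`
finite, is compact in the `I`-adic topology. -/
theorem compactSpace_adicTopology {R : Type*} [CommRing R] [IsNoetherianRing R] (I : Ideal R)
    [IsAdicComplete I R] [Finite (R ⧸ I)] : @CompactSpace R I.adicTopology := by
  let : WithIdeal R := ⟨I⟩
  have hI : IsAdic I := rfl
  have hc : CompleteSpace R := (hI.isAdicComplete_iff.mp inferInstance).1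
  change CompactSpace R
  refine ⟨isCompact_iff_totallyBounded_isComplete.mpr ⟨?_, completeSpace_iff_isComplete_univ.mp hc⟩⟩
  refine totallyBounded_iff_subset_finite_iUnion_nhds_zero.mpr fun U hU => ?_
  obtain ⟨n, -, hn⟩ := hI.hasBasis_nhds_zero.mem_iff.mp hU
  have hf : Finite (R ⧸ I ^ n) := Ideal.finite_quotient_pow (IsNoetherian.noetherian I) n
  refine ⟨Set.range fun x : R ⧸ I ^ n => Quotient.out x, Set.finite_range _, fun a _ => ?_⟩
  refine Set.mem_iUnion₂.mpr ⟨_, ⟨Ideal.Quotient.mk (I ^ n) a, rfl⟩, ?_⟩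
  refine Set.mem_vadd_set.mpr ⟨a - Quotient.out (Ideal.Quotient.mk (I ^ n) a), hn ?_, by simp⟩
  refine Ideal.Quotient.eq.mp ?_
  exact (Ideal.Quotient.mk_out _).symm

section HaarMatrix

variable (R : Type*) [CommRing R] [IsLocalRing R] (n : ℕ)

/-- The topology on `n × n` matrices over a local ring `R`: the product topology, `R` carrying the
topology defined by the powers of its maximal ideal. -/
@[reducible] def matrixTopology : TopologicalSpace (Matrix (Fin n) (Fin n) R) :=
  @instTopologicalSpaceMatrix (Fin n) (Fin n) R (maximalIdeal R).adicTopology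

/-- The Borel σ-algebra on `n × n` matrices. -/
@[reducible] def matrixBorel : MeasurableSpace (Matrix (Fin n) (Fin n) R) :=
  @borel _ (matrixTopology R n)

theorem compactSpace_matrix [IsNoetherianRing R] [IsAdicComplete (maximalIdeal R) R]
    [Finite (ResidueField R)] :
    @CompactSpace (Matrix (Fin n) (Fin n) R) (matrixTopology R n) := by
  let := (maximalIdeal R).adicTopology
  have : Finite (R ⧸ maximalIdeal R) := inferInstanceAs (Finite (ResidueField R))
  have : CompactSpace R := compactSpace_adicTopology (maximalIdeal R)
  exact inferInstanceAs (CompactSpace (Fin n → Fin n → R))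

/-- The Haar probability measure on the compact additive group of `n × n` matrices over a complete
Noetherian local ring `R` with finite residue field: the Haar measure of total mass `1`. -/
noncomputable def haarMatrix [IsNoetherianRing R] [IsAdicComplete (maximalIdeal R) R]
    [Finite (ResidueField R)] :
    @Measure (Matrix (Fin n) (Fin n) R) (matrixBorel R n) :=
  letI := (maximalIdeal R).adicTopology
  letI := matrixBorel R n
  haveI : BorelSpace (Matrix (Fin n) (Fin n) R) := ⟨rfl⟩
  haveI : IsTopologicalRing R :=
    (maximalIdeal R).adic_basis.toRing_subgroups_basis.toRingFilterBasis.isTopologicalRing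
  haveI : CompactSpace (Matrix (Fin n) (Fin n) R) := compactSpace_matrix R n
  Measure.addHaarMeasure ⊤

end HaarMatrix

/-- The cokernel of the `R`-linear endomorphism of `Rⁿ` given by a matrix `M`. -/
abbrev Matrix.coker {R : Type*} [CommRing R] {n : ℕ} (M : Matrix (Fin n) (Fin n) R) : Type _ :=
  (Fin n → R) ⧸ LinearMap.range M.mulVecLin

/-- The set of `n × n` matrices `A` such that `coker (P_j(A)) = 0` for every index `j` other than the
last one, and `coker (P_j(A)) ≅ H` as an `R`-module for the last index `j`. -/
def cokerEvent {R : Type*} [CommRing R] {r : ℕ} (P : Fin (r + 1) → R[X])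
    (H : Type*) [AddCommGroup H] [Module R H] (n : ℕ) : Set (Matrix (Fin n) (Fin n) R) :=
  {A | (∀ j : Fin r, Subsingleton (aeval A (P j.castSucc)).coker) ∧
    Nonempty ((aeval A (P (Fin.last r))).coker ≃ₗ[R] H)}

/-!
The event depends only on `A` modulo `𝔪 ^ (N + 1)`, where `𝔪 ^ N` kills `H`
(`nonempty_coker_map_linearEquiv_iff`, by Nakayama's lemma), so its Haar measure is a proportion of
matrices over the finite local principal ring `S = R ⧸ 𝔪 ^ (N + 1)` (`haarMatrix_preimage`). After
the translation that turns the linear polynomial into `t`, the matrices to be counted have cokernel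
`H` and a reduction in a certain set `T` of matrices over the residue field `F`.

* Given that the cokernel is `H`, the reduction is uniformly distributed on the matrices over `F`
  whose corank is the number `d` of generators of `H`, because multiplication by invertible matrices
  on both sides permutes these transitively and lifts to `S` (`ncard_coker_inter_mul`). Hence the
  proportion sought is the proportion of matrices with cokernel `H`, multiplied by the conditional
  probability that a matrix over `F` lies in `T`, given that its corank is `d`.

* The proportion of matrices with cokernel `H` comes from counting the pairs of a surjection
  `φ : Sⁿ → H` and a matrix with image `ker φ`; such a pair is the same as a matrix with an
  isomorphism of its cokernel with `H`. Here `ker φ` needs exactly `n` generators, since it contains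
  all elements of `Sⁿ` killed by `𝔪` (`ncard_coker_mul_card_aut`).

* Over `F`, a matrix makes `Fⁿ` an `F[X]`-module `V`. The average number of surjections from `V` to
  a fixed finite module tends to `1` (`sum_card_surjective_aeval`). For pairwise coprime irreducible
  `p j`, the surjections to `∏ j, (F[X] / (p j)) ^ (k j)` are counted by a product of functions of
  the dimensions `m j` of `V / p j V`. Gaussian inversion (`sum_invCoeff_mul_qDesc`) expresses the
  indicator function of `m = l` through these counts, and by dominated convergence the limit
  probability of `m = l` is a product over `j` (`tendsto_ncard_primeCorank`). For `l j = 0` the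
  factor is Euler's product (`tsum_invCoeff_zero`). The factor of the linear polynomial also is the
  limit probability of corank `d`, so it cancels in the conditional probability; it is not zero
  (`tsum_invCoeff_ne_zero`).
-/

/-! ### Gaussian inversion and Euler's identity -/

/-- The product `(Q ^ m - 1) (Q ^ m - Q) ⋯ (Q ^ m - Q ^ (k - 1))`. If `Q` is the order of a finite
field, it is the number of surjective linear maps from an `m`-dimensional space to a
`k`-dimensional one. -/
def qDesc (Q : ℝ) (m k : ℕ) : ℝ := ∏ i ∈ Finset.range k, (Q ^ m - Q ^ i)

/-- The product `(Q - 1) (Q ^ 2 - 1) ⋯ (Q ^ k - 1)`. -/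
def qFac (Q : ℝ) (k : ℕ) : ℝ := ∏ i ∈ Finset.range k, (Q ^ (i + 1) - 1)

theorem qDesc_eq_zero (Q : ℝ) {m k : ℕ} (h : m < k) : qDesc Q m k = 0 :=
  Finset.prod_eq_zero (Finset.mem_range.mpr h) (sub_self _)

/-- Counts surjections to a space of dimension `l + k` by their composition with a projection to a
space of dimension `l`. -/
theorem qDesc_add (Q : ℝ) (m l k : ℕ) :
    qDesc Q (l + m) (l + k) = qDesc Q (l + m) l * ((Q ^ l) ^ k * qDesc Q m k) := by
  unfold qDesc
  rw [Finset.prod_range_add]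
  congr 1
  rw [← Finset.card_range k, ← Finset.prod_const, Finset.card_range, ← Finset.prod_mul_distrib]
  exact Finset.prod_congr rfl fun i _ => by ring

theorem qFac_succ (Q : ℝ) (k : ℕ) : qFac Q (k + 1) = qFac Q k * (Q ^ (k + 1) - 1) :=
  Finset.prod_range_succ _ _

theorem qFac_pos {Q : ℝ} (hQ : 1 < Q) (k : ℕ) : 0 < qFac Q k :=
  Finset.prod_pos fun i _ => sub_pos.mpr (one_lt_pow₀ hQ (Nat.succ_ne_zero i))

theorem qDesc_self_pos {Q : ℝ} (hQ : 1 < Q) (k : ℕ) : 0 < qDesc Q k k :=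
  Finset.prod_pos fun _ hi => sub_pos.mpr (pow_lt_pow_right₀ hQ (Finset.mem_range.mp hi))

/-- The partial sums of the alternating sum that detects `m = 0` have a closed form. -/
theorem sum_qDesc_div_qFac_eq_prod {Q : ℝ} (hQ : 1 < Q) (m K : ℕ) :
    ∑ i ∈ Finset.range (K + 1), (-1) ^ i * qDesc Q m i / qFac Q i =
      ∏ i ∈ Finset.range K, (Q ^ (i + 1) - Q ^ m) / (Q ^ (i + 1) - 1) := by
  have hne (i : ℕ) : Q ^ (i + 1) - 1 ≠ 0 :=
    (sub_pos.mpr (one_lt_pow₀ hQ (Nat.succ_ne_zero i))).ne'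
  induction K with
  | zero => simp [qDesc, qFac]
  | succ K ih =>
    have key : (-1) ^ (K + 1) * qDesc Q m (K + 1) / qFac Q (K + 1) =
        (∏ i ∈ Finset.range K, (Q ^ (i + 1) - Q ^ m) / (Q ^ (i + 1) - 1)) *
          ((1 - Q ^ m) / (Q ^ (K + 1) - 1)) := by
      rw [qFac_succ, qDesc, Finset.prod_range_succ', Finset.prod_div_distrib, ← qFac,
        div_mul_div_comm]
      congr 1
      have hneg (s : Finset ℕ) : ∏ i ∈ s, (Q ^ (i + 1) - Q ^ m) =
          (-1) ^ s.card * ∏ i ∈ s, (Q ^ m - Q ^ (i + 1)) := by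
        rw [← Finset.prod_const, ← Finset.prod_mul_distrib]
        exact Finset.prod_congr rfl fun i _ => by ring
      rw [hneg, Finset.card_range]
      ring
    rw [Finset.sum_range_succ, ih, key, Finset.prod_range_succ, ← mul_one_add]
    congr 1
    have := hne K
    field_simp
    ring

theorem sum_qDesc_div_qFac {Q : ℝ} (hQ : 1 < Q) {m K : ℕ} (h : m ≤ K) :
    ∑ i ∈ Finset.range (K + 1), (-1) ^ i * qDesc Q m i / qFac Q i = if m = 0 then 1 else 0 := by
  rw [sum_qDesc_div_qFac_eq_prod hQ]
  split_ifs with hm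
  · subst hm
    refine Finset.prod_eq_one fun i _ => ?_
    rw [pow_zero]
    exact div_self (sub_pos.mpr (one_lt_pow₀ hQ (Nat.succ_ne_zero i))).ne'
  · refine Finset.prod_eq_zero (i := m - 1) (Finset.mem_range.mpr (by omega)) ?_
    rw [Nat.sub_add_cancel (Nat.one_le_iff_ne_zero.mpr hm), sub_self, zero_div]

/-- The coefficients that express the indicator function of `m = l` through the numbers
`qDesc Q m (l + i)`, see `sum_invCoeff_mul_qDesc`. -/
noncomputable def invCoeff (Q : ℝ) (l i : ℕ) : ℝ :=
  (-1) ^ i * ((Q ^ l)⁻¹) ^ i / (qFac Q i * qDesc Q l l)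

theorem sum_invCoeff_mul_qDesc {Q : ℝ} (hQ : 1 < Q) (l : ℕ) {m K : ℕ} (h : m ≤ K) :
    ∑ i ∈ Finset.range (K + 1), invCoeff Q l i * qDesc Q m (l + i) = if m = l then 1 else 0 := by
  rcases lt_or_ge m l with hml | hml
  · rw [if_neg hml.ne]
    exact Finset.sum_eq_zero fun i _ => by rw [qDesc_eq_zero Q (by omega), mul_zero]
  · obtain ⟨a, rfl⟩ := Nat.exists_eq_add_of_le hml
    have hQl : Q ^ l ≠ 0 := (pow_pos (by linarith) l).ne'
    have hterm (i : ℕ) : invCoeff Q l i * qDesc Q (l + a) (l + i) =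
        qDesc Q (l + a) l / qDesc Q l l * ((-1) ^ i * qDesc Q a i / qFac Q i) := by
      rw [invCoeff, qDesc_add]
      have h1 := (qFac_pos hQ i).ne'
      have h2 := (qDesc_self_pos hQ l).ne'
      have h3 : ((Q ^ l)⁻¹) ^ i * (Q ^ l) ^ i = 1 := by
        rw [← mul_pow, inv_mul_cancel₀ hQl, one_pow]
      field_simp
      linear_combination (qDesc Q a i * qDesc Q (l + a) l) * h3
    simp_rw [hterm]
    rw [← Finset.mul_sum, sum_qDesc_div_qFac hQ (by omega)]
    rcases Nat.eq_zero_or_pos a with rfl | ha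
    · simp [(qDesc_self_pos hQ l).ne']
    · rw [if_neg (by omega), if_neg (by omega), mul_zero]

/-- Euler's series `∑ (-z) ^ i / ((Q - 1) ⋯ (Q ^ i - 1))`. -/
noncomputable def eulerSeries (Q z : ℝ) : ℝ := ∑' i : ℕ, (-1) ^ i * z ^ i / qFac Q i

theorem summable_inv_qFac {Q : ℝ} (hQ : 1 < Q) : Summable fun i => (qFac Q i)⁻¹ := by
  refine summable_of_ratio_test_tendsto_lt_one zero_lt_one
    (Eventually.of_forall fun i => (inv_pos.mpr (qFac_pos hQ i)).ne') ?_
  have h (i : ℕ) : ‖(qFac Q (i + 1))⁻¹‖ / ‖(qFac Q i)⁻¹‖ = (Q ^ (i + 1) - 1)⁻¹ := by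
    rw [Real.norm_of_nonneg (inv_pos.mpr (qFac_pos hQ _)).le,
      Real.norm_of_nonneg (inv_pos.mpr (qFac_pos hQ _)).le, qFac_succ]
    have := (qFac_pos hQ i).ne'
    field_simp
  simp_rw [h]
  refine tendsto_inv_atTop_zero.comp (tendsto_atTop_add_const_right _ (-1) ?_)
  exact (tendsto_pow_atTop_atTop_of_one_lt hQ).comp (tendsto_add_atTop_nat 1)

theorem norm_eulerTerm_le {Q : ℝ} (hQ : 1 < Q) {z : ℝ} (hz : |z| ≤ 1) (i : ℕ) :
    ‖(-1) ^ i * z ^ i / qFac Q i‖ ≤ (qFac Q i)⁻¹ := by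
  rw [norm_div, norm_mul, norm_pow, norm_neg, norm_one, one_pow, one_mul, norm_pow,
    Real.norm_eq_abs, Real.norm_of_nonneg (qFac_pos hQ i).le, div_eq_mul_inv]
  exact mul_le_of_le_one_left (inv_pos.mpr (qFac_pos hQ i)).le (pow_le_one₀ (abs_nonneg z) hz)

theorem summable_eulerTerm {Q : ℝ} (hQ : 1 < Q) {z : ℝ} (hz : |z| ≤ 1) :
    Summable fun i : ℕ => (-1) ^ i * z ^ i / qFac Q i :=
  (summable_inv_qFac hQ).of_norm_bounded (norm_eulerTerm_le hQ hz)

/-- The functional equation of Euler's series. -/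
theorem eulerSeries_eq_mul {Q : ℝ} (hQ : 1 < Q) {z : ℝ} (hz : |z| ≤ 1) :
    eulerSeries Q z = (1 - z * Q⁻¹) * eulerSeries Q (z * Q⁻¹) := by
  have hQ0 : Q ≠ 0 := by linarith
  have hz' : |z * Q⁻¹| ≤ 1 := by
    rw [abs_mul, abs_of_pos (inv_pos.mpr (zero_lt_one.trans hQ))]
    exact mul_le_one₀ hz (inv_nonneg.mpr (by linarith)) (inv_le_one_of_one_le₀ hQ.le)
  have hs := summable_eulerTerm hQ hz
  have hs' := summable_eulerTerm hQ hz'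
  -- The difference of the two series is the second one, shifted by one term.
  have hdiff : eulerSeries Q z - eulerSeries Q (z * Q⁻¹) =
      -(z * Q⁻¹) * eulerSeries Q (z * Q⁻¹) := by
    unfold eulerSeries
    rw [← hs.tsum_sub hs', (hs.sub hs').tsum_eq_zero_add, ← tsum_mul_left]
    simp only [pow_zero, sub_self, zero_add]
    refine tsum_congr fun i => ?_
    rw [qFac_succ]
    have h1 := (qFac_pos hQ i).ne'
    have h2 : Q ^ (i + 1) - 1 ≠ 0 := (sub_pos.mpr (one_lt_pow₀ hQ (Nat.succ_ne_zero i))).ne'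
    have h3 : z ^ (i + 1) = (z * Q⁻¹) ^ (i + 1) * Q ^ (i + 1) := by
      rw [← mul_pow, inv_mul_cancel_right₀ hQ0]
    rw [h3]
    generalize z * Q⁻¹ = w
    field_simp
    ring
  linear_combination hdiff

theorem eulerSeries_eq_prod_mul {Q : ℝ} (hQ : 1 < Q) {z : ℝ} (hz : |z| ≤ 1) (K : ℕ) :
    eulerSeries Q z =
      (∏ i ∈ Finset.range K, (1 - z * (Q ^ (i + 1))⁻¹)) * eulerSeries Q (z * (Q ^ K)⁻¹) := by
  induction K with
  | zero => simp
  | succ K ih =>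
    have hz' : |z * (Q ^ K)⁻¹| ≤ 1 := by
      rw [abs_mul, abs_of_pos (inv_pos.mpr (pow_pos (zero_lt_one.trans hQ) K))]
      exact mul_le_one₀ hz (inv_nonneg.mpr (pow_nonneg (by linarith) K))
        (inv_le_one_of_one_le₀ (one_le_pow₀ hQ.le))
    rw [ih, eulerSeries_eq_mul hQ hz', Finset.prod_range_succ, pow_succ, mul_inv]
    simp only [mul_assoc]

theorem tendsto_eulerSeries {Q : ℝ} (hQ : 1 < Q) {z : ℝ} (hz : |z| ≤ 1) :
    Tendsto (fun K : ℕ => eulerSeries Q (z * (Q ^ K)⁻¹)) atTop (𝓝 1) := by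
  have hz0 : Tendsto (fun K : ℕ => z * (Q ^ K)⁻¹) atTop (𝓝 0) := by
    simpa using (tendsto_inv_atTop_zero.comp (tendsto_pow_atTop_atTop_of_one_lt hQ)).const_mul z
  have h1 : ∑' i : ℕ, (-1) ^ i * (0 : ℝ) ^ i / qFac Q i = 1 := by
    rw [tsum_eq_single 0 fun i hi => by simp [hi]]
    simp [qFac]
  rw [← h1]
  refine tendsto_tsum_of_dominated_convergence (summable_inv_qFac hQ)
    (fun i => ((hz0.pow i).const_mul _).div_const _) (Eventually.of_forall fun K i => ?_)
  refine norm_eulerTerm_le hQ ?_ i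
  rw [abs_mul, abs_of_pos (inv_pos.mpr (pow_pos (zero_lt_one.trans hQ) K))]
  exact mul_le_one₀ hz (inv_nonneg.mpr (pow_nonneg (by linarith) K))
    (inv_le_one_of_one_le₀ (one_le_pow₀ hQ.le))

theorem multipliable_one_sub_inv_pow {Q : ℝ} (hQ : 1 < Q) :
    Multipliable fun i : ℕ => 1 - (Q ^ (i + 1))⁻¹ := by
  have hs : Summable fun i : ℕ => -(Q ^ (i + 1))⁻¹ := by
    have := summable_geometric_of_lt_one (inv_nonneg.mpr (by linarith)) (inv_lt_one_of_one_lt₀ hQ)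
    simpa [inv_pow] using ((summable_nat_add_iff 1).mpr this).neg
  simpa [sub_eq_add_neg] using multipliable_one_add_of_summable hs.norm

theorem tendsto_prod_one_sub_inv_pow {Q : ℝ} (hQ : 1 < Q) :
    Tendsto (fun n => ∏ i ∈ Finset.range n, (1 - (Q ^ (i + 1))⁻¹)) atTop
      (𝓝 (∏' i : ℕ, (1 - (Q ^ (i + 1))⁻¹))) :=
  (multipliable_one_sub_inv_pow hQ).hasProd.tendsto_prod_nat

/-- Euler's identity. -/
theorem eulerSeries_one {Q : ℝ} (hQ : 1 < Q) :
    eulerSeries Q 1 = ∏' i : ℕ, (1 - (Q ^ (i + 1))⁻¹) := by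
  have h := (tendsto_prod_one_sub_inv_pow hQ).mul (tendsto_eulerSeries hQ (z := 1) (by simp))
  rw [mul_one] at h
  refine tendsto_nhds_unique ?_ h
  have h2 (K : ℕ) := eulerSeries_eq_prod_mul hQ (z := 1) (by simp) K
  simp only [one_mul] at h2 ⊢
  simp_rw [← h2]
  exact tendsto_const_nhds

theorem abs_inv_pow_le_one {Q : ℝ} (hQ : 1 < Q) (l : ℕ) : |(Q ^ l)⁻¹| ≤ 1 := by
  rw [abs_of_pos (inv_pos.mpr (pow_pos (zero_lt_one.trans hQ) l))]
  exact inv_le_one_of_one_le₀ (one_le_pow₀ hQ.le)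

theorem eulerSeries_inv_pow_ne_zero {Q : ℝ} (hQ : 1 < Q) (l : ℕ) :
    eulerSeries Q (Q ^ l)⁻¹ ≠ 0 := by
  have hz := abs_inv_pow_le_one hQ l
  obtain ⟨K, hK⟩ := ((tendsto_eulerSeries hQ hz).eventually_ne one_ne_zero).exists
  rw [eulerSeries_eq_prod_mul hQ hz K]
  refine mul_ne_zero (Finset.prod_ne_zero_iff.mpr fun i _ => ?_) hK
  rw [← mul_inv, ← pow_add]
  exact (sub_pos.mpr (inv_lt_one_of_one_lt₀ (one_lt_pow₀ hQ (Nat.succ_ne_zero _)))).ne'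

theorem summable_norm_invCoeff {Q : ℝ} (hQ : 1 < Q) (l : ℕ) :
    Summable fun i => ‖invCoeff Q l i‖ := by
  have h := ((summable_eulerTerm hQ (abs_inv_pow_le_one hQ l)).mul_right (qDesc Q l l)⁻¹).norm
  refine h.congr fun i => ?_
  rw [invCoeff, ← div_eq_mul_inv, div_div]

theorem tsum_invCoeff (Q : ℝ) (l : ℕ) :
    ∑' i, invCoeff Q l i = eulerSeries Q (Q ^ l)⁻¹ * (qDesc Q l l)⁻¹ := by
  rw [eulerSeries, ← tsum_mul_right]
  exact tsum_congr fun i => by rw [invCoeff, ← div_eq_mul_inv, div_div]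

theorem tsum_invCoeff_zero {Q : ℝ} (hQ : 1 < Q) :
    ∑' i, invCoeff Q 0 i = ∏' i : ℕ, (1 - (Q ^ (i + 1))⁻¹) := by
  rw [tsum_invCoeff, pow_zero, inv_one, eulerSeries_one hQ]
  simp [qDesc]

theorem tsum_invCoeff_ne_zero {Q : ℝ} (hQ : 1 < Q) (l : ℕ) : ∑' i, invCoeff Q l i ≠ 0 := by
  rw [tsum_invCoeff]
  exact mul_ne_zero (eulerSeries_inv_pow_ne_zero hQ l) (inv_ne_zero (qDesc_self_pos hQ l).ne')

/-! ### Products of absolutely convergent series -/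

theorem summable_and_tsum_prod_pi {r : ℕ} (f : Fin r → ℕ → ℝ)
    (hf : ∀ j, Summable fun i => ‖f j i‖) :
    (Summable fun k : Fin r → ℕ => ‖∏ j, f j (k j)‖) ∧
      ∑' k : Fin r → ℕ, ∏ j, f j (k j) = ∏ j, ∑' i, f j i := by
  induction r with
  | zero => exact ⟨Summable.of_finite, by simp [tsum_fintype]⟩
  | succ r ih =>
    obtain ⟨ih1, ih2⟩ := ih (fun j => f j.succ) fun j => hf j.succ
    have he (x : ℕ × (Fin r → ℕ)) : ∏ j, f j (Fin.consEquiv (fun _ => ℕ) x j) =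
        f 0 x.1 * ∏ j : Fin r, f j.succ (x.2 j) := by
      rw [Fin.prod_univ_succ]
      rfl
    constructor
    · rw [← (Fin.consEquiv fun _ => ℕ).summable_iff]
      refine (summable_mul_of_summable_norm (hf 0) ih1).norm.congr fun x => ?_
      rw [Function.comp_apply, he]
    · rw [← (Fin.consEquiv fun _ => ℕ).tsum_eq, Fin.prod_univ_succ, ← ih2,
        tsum_mul_tsum_of_summable_norm (hf 0) ih1]
      exact tsum_congr he

/-! ### Counting generating families -/

/-- The proportion of generating families among the families of `n` vectors in a `k`-dimensional
vector space over a field with `Q` elements. -/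
noncomputable def genDensity (Q : ℝ) (n k : ℕ) : ℝ := qDesc Q n k / (Q ^ n) ^ k

theorem genDensity_eq_prod {Q : ℝ} (hQ : 1 < Q) (n k : ℕ) :
    genDensity Q n k = ∏ i ∈ Finset.range k, (1 - Q ^ i * (Q ^ n)⁻¹) := by
  have h0 : Q ^ n ≠ 0 := (pow_pos (by linarith) n).ne'
  unfold genDensity qDesc
  rw [← Finset.card_range k, ← Finset.prod_const, Finset.card_range, ← Finset.prod_div_distrib]
  exact Finset.prod_congr rfl fun i _ => by field_simp

theorem genDensity_eq_zero (Q : ℝ) {n k : ℕ} (h : n < k) : genDensity Q n k = 0 := by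
  rw [genDensity, qDesc_eq_zero Q h, zero_div]

theorem abs_genDensity_le_one {Q : ℝ} (hQ : 1 < Q) (n k : ℕ) : |genDensity Q n k| ≤ 1 := by
  rcases lt_or_ge n k with h | h
  · simp [genDensity_eq_zero Q h]
  · rw [genDensity_eq_prod hQ, Finset.abs_prod]
    refine Finset.prod_le_one (fun _ _ => abs_nonneg _) fun i hi => ?_
    have h0 : 0 < Q ^ n := pow_pos (by linarith) n
    have h1 : Q ^ i * (Q ^ n)⁻¹ ≤ 1 := by
      rw [← div_eq_mul_inv, div_le_one h0]
      exact pow_le_pow_right₀ hQ.le ((Finset.mem_range.mp hi).le.trans h)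
    have h2 : 0 ≤ Q ^ i * (Q ^ n)⁻¹ := by positivity
    rw [abs_le]
    constructor <;> linarith

theorem tendsto_genDensity {Q : ℝ} (hQ : 1 < Q) (k : ℕ) :
    Tendsto (fun n => genDensity Q n k) atTop (𝓝 1) := by
  simp_rw [genDensity_eq_prod hQ]
  have h (i : ℕ) : Tendsto (fun n : ℕ => 1 - Q ^ i * (Q ^ n)⁻¹) atTop (𝓝 1) := by
    simpa using ((tendsto_inv_atTop_zero.comp
      (tendsto_pow_atTop_atTop_of_one_lt hQ)).const_mul (Q ^ i)).const_sub 1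
  simpa using tendsto_finsetProd (Finset.range k) fun i _ => h i

theorem genDensity_self {Q : ℝ} (hQ : 1 < Q) (n : ℕ) :
    genDensity Q n n = ∏ i ∈ Finset.range n, (1 - (Q ^ (i + 1))⁻¹) := by
  rw [genDensity_eq_prod hQ, ← Finset.prod_range_reflect]
  refine Finset.prod_congr rfl fun i hi => ?_
  have hi := Finset.mem_range.mp hi
  have h : n = (n - 1 - i) + (i + 1) := by omega
  have h0 : Q ≠ 0 := by linarith
  rw [show (Q ^ n)⁻¹ = (Q ^ (n - 1 - i))⁻¹ * (Q ^ (i + 1))⁻¹ by rw [← mul_inv, ← pow_add, ← h],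
    mul_inv_cancel_left₀ (pow_ne_zero _ h0)]

/-- All fibers of a surjective homomorphism of finite groups have the same size. -/
theorem AddMonoidHom.card_preimage_mul_card {G K : Type*} [AddGroup G] [AddGroup K] [Finite G]
    (f : G →+ K) (hf : Function.Surjective f) (T : Set K) :
    (f ⁻¹' T).ncard * Nat.card K = T.ncard * Nat.card G := by
  have : Finite K := Finite.of_surjective f hf
  have hfib (t : K) : Nonempty ({x : G // f x = t} ≃ f.ker) := by
    obtain ⟨x₀, rfl⟩ := hf t
    refine ⟨(Equiv.addLeft (-x₀)).subtypeEquiv fun x => ?_⟩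
    rw [Equiv.coe_addLeft, AddMonoidHom.mem_ker, map_add, map_neg, neg_add_eq_zero, eq_comm]
  have key (T : Set K) : (f ⁻¹' T).ncard = T.ncard * Nat.card f.ker := by
    rw [← Nat.card_coe_set_eq, ← Nat.card_coe_set_eq, ← Nat.card_prod]
    have e1 : (f ⁻¹' T : Set G) ≃ Σ t : T, {x : G // f x = t} :=
      { toFun := fun x => ⟨⟨f x, x.2⟩, ⟨x, rfl⟩⟩
        invFun := fun y => ⟨y.2, by simp [y.2.2]⟩
        left_inv := fun x => rfl
        right_inv := by
          rintro ⟨⟨t, ht⟩, ⟨x, hx⟩⟩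
          change f x = t at hx
          subst hx
          rfl }
    exact Nat.card_congr (e1.trans ((Equiv.sigmaCongrRight fun t : T =>
      (hfib t).some).trans (Equiv.sigmaEquivProd _ _)))
  have h2 := key Set.univ
  rw [Set.preimage_univ, Set.ncard_univ, Set.ncard_univ] at h2
  rw [key T, h2]
  ring

section Field

variable {F W : Type*} [Field F] [Finite F] [AddCommGroup W] [Module F W] [Finite W]

/-- Row rank equals column rank, which turns generating families into independent ones. -/
theorem linearIndependent_row_transpose_iff {F : Type*} [Field F] {n d : ℕ}
    (M : Matrix (Fin n) (Fin d) F) :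
    LinearIndependent F M.transpose.row ↔ Submodule.span F (Set.range M.row) = ⊤ := by
  have h1 : (Set.range M.transpose.row).finrank F = M.transpose.rank :=
    (Matrix.rank_eq_finrank_span_row _).symm
  have h2 : Module.finrank F (Submodule.span F (Set.range M.row)) = M.rank :=
    (Matrix.rank_eq_finrank_span_row _).symm
  rw [linearIndependent_iff_card_eq_finrank_span, h1, Matrix.rank_transpose, ← h2]
  constructor
  · intro h
    exact Submodule.eq_top_of_finrank_eq (by rw [← h]; simp)
  · intro h
    rw [h]
    simp

/-- The number of families of `n` vectors that generate a vector space over a finite field. -/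
theorem card_span_eq_top (n : ℕ) :
    (Nat.card {w : Fin n → W // Submodule.span F (Set.range w) = ⊤} : ℝ) =
      qDesc (Nat.card F) n (Module.finrank F W) := by
  have := Fintype.ofFinite F
  have : Module.Finite F W := Module.Finite.of_finite
  set d := Module.finrank F W
  let b : W ≃ₗ[F] (Fin d → F) := (Module.finBasis F W).equivFun
  have e1 : {w : Fin n → W // Submodule.span F (Set.range w) = ⊤} ≃
      {s : Fin d → Fin n → F // LinearIndependent F s} := by
    refine ((Equiv.arrowCongr (Equiv.refl (Fin n)) b.toEquiv).trans
      (Equiv.piComm fun _ _ => F)).subtypeEquiv fun w => ?_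
    have h := linearIndependent_row_transpose_iff (Matrix.of fun i => b (w i))
    refine Iff.trans ?_ h.symm
    have h3 : Set.range (Matrix.of fun i => b (w i)).row = b '' Set.range w := by
      rw [← Set.range_comp]
      rfl
    rw [h3, ← LinearEquiv.coe_coe, ← Submodule.map_span]
    exact (Submodule.map_eq_top_iff (e := b)).symm
  rw [Nat.card_congr e1]
  rcases lt_or_ge n d with h | h
  · rw [qDesc_eq_zero _ h]
    have : IsEmpty {s : Fin d → Fin n → F // LinearIndependent F s} := by
      refine ⟨fun s => ?_⟩
      have := s.2.fintype_card_le_finrank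
      simp at this
      omega
    simp
  · rw [card_linearIndependent (by simpa using h), Module.finrank_fin_fun, qDesc,
      Finset.prod_range, Nat.cast_prod]
    refine Finset.prod_congr rfl fun i _ => ?_
    rw [Nat.card_eq_fintype_card, Nat.cast_sub, Nat.cast_pow, Nat.cast_pow]
    exact Nat.pow_le_pow_right Fintype.card_pos (i.2.le.trans h)

/-- The number of surjective linear maps between vector spaces over a finite field. -/
theorem card_surjective_linearMap {U : Type*} [AddCommGroup U] [Module F U] [Finite U] :
    (Nat.card {f : U →ₗ[F] W // Function.Surjective f} : ℝ) =
      qDesc (Nat.card F) (Module.finrank F U) (Module.finrank F W) := by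
  have : Module.Finite F U := Module.Finite.of_finite
  rw [← card_span_eq_top]
  congr 1
  refine Nat.card_congr (((Module.finBasis F U).constr ℕ).symm.toEquiv.subtypeEquiv fun f => ?_)
  obtain ⟨g, rfl⟩ := ((Module.finBasis F U).constr ℕ (M' := W)).surjective f
  rw [← LinearMap.range_eq_top, Module.Basis.constr_range]
  simp

end Field

theorem finrank_eq_of_card_eq {F W : Type*} [Field F] [Finite F] [AddCommGroup W] [Module F W]
    [Finite W] {d : ℕ} (h : Nat.card W = Nat.card F ^ d) : Module.finrank F W = d := by
  have : Module.Finite F W := Module.Finite.of_finite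
  rw [Module.natCard_eq_pow_finrank (K := F)] at h
  exact Nat.pow_right_injective Finite.one_lt_card h

section Local

variable {S : Type*} [CommRing S] [IsLocalRing S] [Finite S]
variable {K : Type*} [AddCommGroup K] [Module S K] [Finite K]

/-- The number of families of `n` vectors that generate a finite module `K` over a finite local
ring: by Nakayama's lemma, generation is decided in `K / 𝔪 K`. -/
theorem card_span_eq_top_of_isLocalRing {d : ℕ}
    (hd : Nat.card (K ⧸ maximalIdeal S • (⊤ : Submodule S K)) = Nat.card (ResidueField S) ^ d)
    (n : ℕ) :
    (Nat.card {v : Fin n → K // Submodule.span S (Set.range v) = ⊤} : ℝ) =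
      (Nat.card K : ℝ) ^ n * genDensity (Nat.card (ResidueField S)) n d := by
  have : Module.Finite S K := Module.Finite.of_finite
  let : Field (S ⧸ maximalIdeal S) := Ideal.Quotient.field _
  change Nat.card _ = Nat.card (S ⧸ maximalIdeal S) ^ d at hd
  change _ = _ * genDensity (Nat.card (S ⧸ maximalIdeal S)) n d
  have : Finite (S ⧸ maximalIdeal S) := Finite.of_surjective _ Ideal.Quotient.mk_surjective
  have : Finite (K ⧸ maximalIdeal S • (⊤ : Submodule S K)) :=
    Finite.of_surjective _ (Submodule.mkQ_surjective _)
  have hV := card_span_eq_top (F := S ⧸ maximalIdeal S)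
    (W := K ⧸ maximalIdeal S • (⊤ : Submodule S K)) n
  rw [finrank_eq_of_card_eq hd] at hV
  let f : (Fin n → K) →+ (Fin n → K ⧸ maximalIdeal S • (⊤ : Submodule S K)) :=
    (maximalIdeal S • (⊤ : Submodule S K)).mkQ.toAddMonoidHom.compLeft (Fin n)
  have hf : Function.Surjective f := fun w =>
    ⟨fun i => (Submodule.mkQ_surjective _ (w i)).choose,
      funext fun i => (Submodule.mkQ_surjective _ (w i)).choose_spec⟩
  have hpre : {v : Fin n → K | Submodule.span S (Set.range v) = ⊤} =
      f ⁻¹' {w | Submodule.span (S ⧸ maximalIdeal S) (Set.range w) = ⊤} := by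
    ext v
    have h1 : Set.range (f v) =
        (maximalIdeal S • (⊤ : Submodule S K)).mkQ '' Set.range v := by
      rw [← Set.range_comp]
      rfl
    have h2 : Submodule.restrictScalars S (Submodule.span (S ⧸ maximalIdeal S)
        (Set.range (f v))) = Submodule.span S (Set.range (f v)) :=
      Submodule.restrictScalars_span S (S ⧸ maximalIdeal S) Ideal.Quotient.mk_surjective _
    rw [Set.mem_preimage, Set.mem_ofPred_eq, Set.mem_ofPred_eq,
      ← Submodule.restrictScalars_eq_top_iff S (S ⧸ maximalIdeal S), h2, h1, ← Submodule.map_span]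
    exact IsLocalRing.map_mkQ_eq_top.symm
  have hcount := f.card_preimage_mul_card hf
    {w | Submodule.span (S ⧸ maximalIdeal S) (Set.range w) = ⊤}
  rw [← hpre, ← Nat.card_coe_set_eq, ← Nat.card_coe_set_eq, Nat.card_fun, Nat.card_fun, hd,
    Nat.card_fin] at hcount
  have hcount' : (Nat.card {v : Fin n → K // Submodule.span S (Set.range v) = ⊤} : ℝ) *
      ((Nat.card (S ⧸ maximalIdeal S) : ℝ) ^ d) ^ n =
      Nat.card {w : Fin n → K ⧸ maximalIdeal S • (⊤ : Submodule S K) //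
        Submodule.span (S ⧸ maximalIdeal S) (Set.range w) = ⊤} * (Nat.card K : ℝ) ^ n := by
    exact_mod_cast hcount
  have hq : (Nat.card (S ⧸ maximalIdeal S) : ℝ) ≠ 0 := by
    exact_mod_cast (Nat.card_pos (α := S ⧸ maximalIdeal S)).ne'
  rw [hV] at hcount'
  rw [genDensity, ← mul_div_assoc, eq_div_iff (pow_ne_zero _ (pow_ne_zero _ hq)), ← pow_mul,
    mul_comm n d, pow_mul, hcount', mul_comm]

end Local

/-! ### Surjections onto semisimple modules over a polynomial ring -/

/-- By the Chinese remainder theorem, maps to modules killed by pairwise coprime ideals are jointly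
surjective if each of them is. -/
theorem LinearMap.surjective_pi_iff_of_pairwise_isCoprime {A ι M : Type*} [CommRing A] [Finite ι]
    [AddCommGroup M] [Module A M] {N : ι → Type*} [∀ j, AddCommGroup (N j)]
    [∀ j, Module A (N j)] {I : ι → Ideal A} (hI : Pairwise (Function.onFun IsCoprime I))
    (hN : ∀ j, ∀ a ∈ I j, ∀ x : N j, a • x = 0) (f : ∀ j, M →ₗ[A] N j) :
    Function.Surjective (LinearMap.pi f) ↔ ∀ j, Function.Surjective (f j) := by
  classical
  constructor
  · intro h j y
    obtain ⟨x, hx⟩ := h (Pi.single j y)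
    exact ⟨x, by simpa using congrFun hx j⟩
  · intro h y
    have := Fintype.ofFinite ι
    choose x hx using fun j => h j (y j)
    choose e he using fun j => Ideal.exists_forall_sub_mem_ideal hI (Pi.single j (1 : A))
    refine ⟨∑ j, e j • x j, funext fun i => ?_⟩
    have hterm (j : ι) : f i (e j • x j) = (Pi.single j (1 : A) : ι → A) i • f i (x j) := by
      rw [map_smul, ← sub_eq_zero, ← sub_smul]
      exact hN i _ (he j i) _
    rw [LinearMap.pi_apply, map_sum, Finset.sum_congr rfl fun j _ => hterm j,
      Finset.sum_eq_single i]
    · simp [hx]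
    · intro j _ hji
      simp [Pi.single_eq_of_ne hji.symm]
    · simp

theorem smul_pi_quotient_eq_zero {A : Type*} [CommRing A] (I : Ideal A) {k : ℕ} {a : A} (ha : a ∈ I)
    (x : Fin k → A ⧸ I) : a • x = 0 := by
  funext i
  change Ideal.Quotient.mk I a * x i = 0
  rw [Ideal.Quotient.eq_zero_iff_mem.mpr ha, zero_mul]

theorem card_surjective_quotient_eq {A M : Type*} [CommRing A] (I : Ideal A) [AddCommGroup M]
    [Module A M] (k : ℕ) :
    Nat.card {f : M →ₗ[A] (Fin k → A ⧸ I) // Function.Surjective f} =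
      Nat.card {g : (M ⧸ I • (⊤ : Submodule A M)) →ₗ[A ⧸ I] (Fin k → A ⧸ I) //
        Function.Surjective g} := by
  have hsurj : Function.Surjective (algebraMap A (A ⧸ I)) := Ideal.Quotient.mk_surjective
  have hker (f : M →ₗ[A] (Fin k → A ⧸ I)) : I • (⊤ : Submodule A M) ≤ LinearMap.ker f :=
    Submodule.smul_le.mpr fun a ha x _ => by
      rw [LinearMap.mem_ker, map_smul, smul_pi_quotient_eq_zero I ha]
  let e : (M →ₗ[A] (Fin k → A ⧸ I)) ≃
      ((M ⧸ I • (⊤ : Submodule A M)) →ₗ[A ⧸ I] (Fin k → A ⧸ I)) :=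
    { toFun := fun f => (Submodule.liftQ _ f (hker f)).extendScalarsOfSurjective hsurj
      invFun := fun g => g.restrictScalars A ∘ₗ Submodule.mkQ _
      left_inv := fun f => rfl
      right_inv := fun g => by
        refine LinearMap.ext fun x => ?_
        obtain ⟨x, rfl⟩ := Submodule.mkQ_surjective _ x
        rfl }
  refine Nat.card_congr (e.subtypeEquiv fun f => ?_)
  have hf : (f : M → _) = e f ∘ Submodule.mkQ _ := rfl
  rw [hf]
  exact ⟨Function.Surjective.of_comp, fun h => h.comp (Submodule.mkQ_surjective _)⟩

/-- The dimension of `M / p M` over `F[X] / (p)`, for an irreducible polynomial `p` and a module `M`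
over `F[X]`. -/
noncomputable def primeCorank {F : Type*} [Field F] (p : F[X]) (M : Type*) [AddCommGroup M]
    [Module F[X] M] : ℕ :=
  Module.finrank (F[X] ⧸ Ideal.span {p}) (M ⧸ Ideal.span {p} • (⊤ : Submodule F[X] M))

section PrimeCorank

variable {F : Type*} [Field F] [Finite F]

theorem finite_quotient_span {p : F[X]} (hp : p ≠ 0) : Finite (F[X] ⧸ Ideal.span {p}) := by
  have : Module.Finite F (F[X] ⧸ Ideal.span {p}) :=
    Module.Finite.equiv (AdjoinRoot.powerBasis hp).basis.equivFun.symm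
  exact Module.finite_of_finite F

theorem card_quotient_span {p : F[X]} (hp : p ≠ 0) :
    Nat.card (F[X] ⧸ Ideal.span {p}) = Nat.card F ^ p.natDegree := by
  have := finite_quotient_span hp
  have : Module.Finite F (F[X] ⧸ Ideal.span {p}) := Module.Finite.of_finite
  rw [Module.natCard_eq_pow_finrank (K := F), finrank_quotient_span_eq_natDegree]

theorem one_lt_natCast_card : (1 : ℝ) < Nat.card F := by
  exact_mod_cast Finite.one_lt_card

theorem one_lt_card_pow_natDegree {p : F[X]} (hp : Irreducible p) :
    (1 : ℝ) < (Nat.card F : ℝ) ^ p.natDegree :=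
  one_lt_pow₀ one_lt_natCast_card hp.natDegree_pos.ne'

variable {M : Type*} [AddCommGroup M] [Module F[X] M] [Finite M]

theorem card_quotient_smul_top {p : F[X]} (hp : Irreducible p) :
    Nat.card (M ⧸ Ideal.span {p} • (⊤ : Submodule F[X] M)) =
      (Nat.card F ^ p.natDegree) ^ primeCorank p M := by
  have : (Ideal.span {p}).IsMaximal := PrincipalIdealRing.isMaximal_of_irreducible hp
  let : Field (F[X] ⧸ Ideal.span {p}) := Ideal.Quotient.field _
  have := finite_quotient_span hp.ne_zero
  have : Finite (M ⧸ Ideal.span {p} • (⊤ : Submodule F[X] M)) :=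
    Finite.of_surjective _ (Submodule.mkQ_surjective _)
  have : Module.Finite (F[X] ⧸ Ideal.span {p}) (M ⧸ Ideal.span {p} • (⊤ : Submodule F[X] M)) :=
    Module.Finite.of_finite
  rw [Module.natCard_eq_pow_finrank (K := F[X] ⧸ Ideal.span {p}), card_quotient_span hp.ne_zero]
  rfl

/-- The number of surjections from a finite `F[X]`-module to `(F[X] / (p)) ^ k`. They factor through
the vector space `M / p M`. -/
theorem card_surjective_of_irreducible {p : F[X]} (hp : Irreducible p) (k : ℕ) :
    (Nat.card {f : M →ₗ[F[X]] (Fin k → F[X] ⧸ Ideal.span {p}) // Function.Surjective f} : ℝ) =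
      qDesc ((Nat.card F : ℝ) ^ p.natDegree) (primeCorank p M) k := by
  have : (Ideal.span {p}).IsMaximal := PrincipalIdealRing.isMaximal_of_irreducible hp
  have := finite_quotient_span hp.ne_zero
  have : Finite (M ⧸ Ideal.span {p} • (⊤ : Submodule F[X] M)) :=
    Finite.of_surjective _ (Submodule.mkQ_surjective _)
  rw [card_surjective_quotient_eq (Ideal.span {p})]
  let : Field (F[X] ⧸ Ideal.span {p}) := Ideal.Quotient.field _
  have h := card_surjective_linearMap (F := F[X] ⧸ Ideal.span {p})
    (U := M ⧸ Ideal.span {p} • (⊤ : Submodule F[X] M)) (W := Fin k → F[X] ⧸ Ideal.span {p})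
  rw [Module.finrank_fin_fun, card_quotient_span hp.ne_zero, Nat.cast_pow] at h
  exact h

theorem card_surjective_pi {r : ℕ} {p : Fin r → F[X]} (hp : ∀ j, Irreducible (p j))
    (hcop : Pairwise (Function.onFun IsCoprime p)) (k : Fin r → ℕ) :
    (Nat.card {f : M →ₗ[F[X]] (∀ j, Fin (k j) → F[X] ⧸ Ideal.span {p j}) //
        Function.Surjective f} : ℝ) =
      ∏ j, qDesc ((Nat.card F : ℝ) ^ (p j).natDegree) (primeCorank (p j) M) (k j) := by
  have hI : Pairwise (Function.onFun IsCoprime fun j => Ideal.span {p j}) := fun i j hij =>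
    (Ideal.isCoprime_span_singleton_iff _ _).mpr (hcop hij)
  let e : (∀ j, M →ₗ[F[X]] (Fin (k j) → F[X] ⧸ Ideal.span {p j})) ≃
      (M →ₗ[F[X]] (∀ j, Fin (k j) → F[X] ⧸ Ideal.span {p j})) :=
    { toFun := LinearMap.pi
      invFun := fun f j => LinearMap.proj j ∘ₗ f
      left_inv := fun f => rfl
      right_inv := fun f => rfl }
  rw [← Nat.card_congr (e.subtypeEquiv fun f =>
    (LinearMap.surjective_pi_iff_of_pairwise_isCoprime hI
      (fun j _ ha x => smul_pi_quotient_eq_zero (Ideal.span {p j}) ha x) f).symm),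
    Nat.card_congr (Equiv.subtypePiEquivPi
      (p := fun j (f : M →ₗ[F[X]] (Fin (k j) → F[X] ⧸ Ideal.span {p j})) => Function.Surjective f)),
    Nat.card_pi, Nat.cast_prod]
  exact Finset.prod_congr rfl fun j _ => card_surjective_of_irreducible (hp j) (k j)

end PrimeCorank

/-! ### Moments of the module defined by a random endomorphism -/

theorem card_comp_eq {F U V : Type*} [Field F] [AddCommGroup U] [Module F U] [Finite U]
    [AddCommGroup V] [Module F V] [Finite V] (g : V →ₗ[F] U)
    (hg : Function.Surjective g) (h : V →ₗ[F] U) :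
    Nat.card {T : V →ₗ[F] V // g ∘ₗ T = h} * Nat.card (V →ₗ[F] U) = Nat.card (V →ₗ[F] V) := by
  have : Finite (V →ₗ[F] V) := Finite.of_injective _ DFunLike.coe_injective
  obtain ⟨s, hs⟩ := g.exists_rightInverse_of_surjective (LinearMap.range_eq_top.mpr hg)
  let c : (V →ₗ[F] V) →+ (V →ₗ[F] U) := (LinearMap.compRight F (M := V) g).toAddMonoidHom
  have hc : Function.Surjective c := fun u => ⟨s ∘ₗ u, by
    change g ∘ₗ s ∘ₗ u = u
    rw [← LinearMap.comp_assoc, hs, LinearMap.id_comp]⟩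
  have := c.card_preimage_mul_card hc {h}
  rw [Set.ncard_singleton, one_mul, ← Nat.card_coe_set_eq] at this
  exact this

section Moments

variable {F V : Type*} [Field F] [Finite F] [AddCommGroup V] [Module F V] [Finite V]

/-- The average number of surjections from the `F[X]`-module defined by a random endomorphism to a
finite `F[X]`-module `N` depends only on the dimension of `N`, and it tends to `1` as the dimension
of the vector space grows: every linear surjection `g` to `N` is equivariant for a set of
endomorphisms of the same size. -/
theorem sum_card_surjective_aeval [Fintype (V →ₗ[F] V)] (N : Type*) [AddCommGroup N]
    [Module F N] [Module F[X] N] [IsScalarTower F F[X] N] [Finite N] :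
    ∑ T : V →ₗ[F] V, (Nat.card {f : Module.AEval' T →ₗ[F[X]] N // Function.Surjective f} : ℝ) =
      Nat.card (V →ₗ[F] V) *
        genDensity (Nat.card F) (Module.finrank F V) (Module.finrank F N) := by
  have : Module.Finite F V := Module.Finite.of_finite
  have : Module.Finite F N := Module.Finite.of_finite
  have : Finite (V →ₗ[F] N) := Finite.of_injective _ DFunLike.coe_injective
  have (T : V →ₗ[F] V) : Finite (Module.AEval' T) := Finite.of_equiv _ (Module.AEval'.of T).toEquiv
  have (T : V →ₗ[F] V) : Finite (Module.AEval' T →ₗ[F[X]] N) :=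
    Finite.of_injective _ DFunLike.coe_injective
  let x : N →ₗ[F] N := (LinearMap.lsmul F[X] N X).restrictScalars F
  let e (T : V →ₗ[F] V) : {f : Module.AEval' T →ₗ[F[X]] N // Function.Surjective f} ≃
      {g : {g : V →ₗ[F] N // Function.Surjective g} // g.1 ∘ₗ T = x ∘ₗ g.1} :=
    { toFun := fun f => ⟨⟨f.1.restrictScalars F ∘ₗ (Module.AEval'.of T).toLinearMap,
          f.2.comp (Module.AEval'.of T).surjective⟩, by
        ext v
        change f.1 (Module.AEval'.of T (T v)) = (X : F[X]) • f.1 (Module.AEval'.of T v)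
        rw [← Module.AEval'.X_smul_of, map_smul]⟩
      invFun := fun g => ⟨LinearMap.ofAEval T g.1.1 fun v => LinearMap.congr_fun g.2 v,
        g.1.2.comp (Module.AEval'.of T).symm.surjective⟩
      left_inv := fun f => rfl
      right_inv := fun g => rfl }
  have hswap : ∑ T : V →ₗ[F] V,
      Nat.card {f : Module.AEval' T →ₗ[F[X]] N // Function.Surjective f} =
      Nat.card (Σ g : {g : V →ₗ[F] N // Function.Surjective g},
        {T : V →ₗ[F] V // g.1 ∘ₗ T = x ∘ₗ g.1}) := by
    rw [← Nat.card_sigma]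
    exact Nat.card_congr
      { toFun := fun y => ⟨(e y.1 y.2).1, y.1, (e y.1 y.2).2⟩
        invFun := fun y => ⟨y.2.1, (e y.2.1).symm ⟨y.1, y.2.2⟩⟩
        left_inv := fun y => rfl
        right_inv := fun y => rfl }
  have := Fintype.ofFinite {g : V →ₗ[F] N // Function.Surjective g}
  have hN : (Nat.card (V →ₗ[F] N) : ℝ) =
      ((Nat.card F : ℝ) ^ Module.finrank F V) ^ Module.finrank F N := by
    rw [Module.natCard_eq_pow_finrank (K := F), Module.finrank_linearMap, pow_mul]
    push_cast
    rfl
  have hN0 : (Nat.card (V →ₗ[F] N) : ℝ) ≠ 0 := by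
    rw [hN]
    exact pow_ne_zero _ (pow_ne_zero _ (zero_lt_one.trans one_lt_natCast_card).ne')
  have hterm (g : {g : V →ₗ[F] N // Function.Surjective g}) :
      (Nat.card {T : V →ₗ[F] V // g.1 ∘ₗ T = x ∘ₗ g.1} : ℝ) =
        Nat.card (V →ₗ[F] V) / Nat.card (V →ₗ[F] N) := by
    rw [eq_div_iff hN0]
    exact_mod_cast card_comp_eq g.1 g.2 (x ∘ₗ g.1)
  rw [← Nat.cast_sum, hswap, Nat.card_sigma, Nat.cast_sum, Finset.sum_congr rfl fun g _ => hterm g,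
    Finset.sum_const, Finset.card_univ, ← Nat.card_eq_fintype_card, nsmul_eq_mul,
    card_surjective_linearMap (F := F) (U := V) (W := N), hN, genDensity]
  ring

theorem primeCorank_le_finrank {p : F[X]} (hp : Irreducible p) (T : V →ₗ[F] V) :
    primeCorank p (Module.AEval' T) ≤ Module.finrank F V := by
  have : Module.Finite F V := Module.Finite.of_finite
  have : Finite (Module.AEval' T) := Finite.of_equiv _ (Module.AEval'.of T).toEquiv
  have h := card_quotient_smul_top (M := Module.AEval' T) hp
  have h2 := Nat.card_le_card_of_surjective _
    (Submodule.mkQ_surjective (Ideal.span {p} • (⊤ : Submodule F[X] (Module.AEval' T))))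
  rw [h, ← Nat.card_congr (Module.AEval'.of T).toEquiv,
    Module.natCard_eq_pow_finrank (K := F) (V := V), ← pow_mul] at h2
  exact (Nat.le_mul_of_pos_left _ hp.natDegree_pos).trans
    ((Nat.pow_le_pow_iff_right Finite.one_lt_card).mp h2)

/-- `V / p(T) V` is the reduction modulo `p` of the `F[X]`-module defined by `T`. -/
theorem card_coker_aeval {p : F[X]} (hp : Irreducible p) (T : V →ₗ[F] V) :
    Nat.card (V ⧸ LinearMap.range (aeval T p)) =
      (Nat.card F ^ p.natDegree) ^ primeCorank p (Module.AEval' T) := by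
  have : Finite (Module.AEval' T) := Finite.of_equiv _ (Module.AEval'.of T).toEquiv
  rw [← card_quotient_smul_top hp]
  have h1 := Submodule.card_eq_card_quotient_mul_card (LinearMap.range (aeval T p))
  have h2 := Submodule.card_eq_card_quotient_mul_card
    (Ideal.span {p} • (⊤ : Submodule F[X] (Module.AEval' T)))
  rw [← Nat.card_congr (Module.AEval'.of T).toEquiv, h1] at h2
  have h3 : Nat.card (LinearMap.range (aeval T p)) =
      Nat.card ↥(Ideal.span {p} • (⊤ : Submodule F[X] (Module.AEval' T))) := by
    refine Nat.card_congr ((Module.AEval'.of T).toEquiv.subtypeEquiv fun v => ?_)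
    rw [Submodule.ideal_span_singleton_smul, LinearMap.mem_range,
      Submodule.mem_smul_pointwise_iff_exists]
    constructor
    · rintro ⟨w, rfl⟩
      exact ⟨Module.AEval'.of T w, trivial, (Module.AEval.of_aeval_smul _ p w).symm⟩
    · rintro ⟨w, -, hw⟩
      obtain ⟨w, rfl⟩ := (Module.AEval'.of T).surjective w
      refine ⟨w, (Module.AEval'.of T).injective ?_⟩
      exact (Module.AEval.of_aeval_smul _ p w).trans hw
  rw [← h3] at h2
  exact Nat.eq_of_mul_eq_mul_left Nat.card_pos h2

variable {r : ℕ} {p : Fin r → F[X]}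

/-- The proportion of endomorphisms with prescribed coranks at finitely many irreducible
polynomials, as a series whose terms are moments. -/
theorem ncard_primeCorank_eq_tsum (hp : ∀ j, Irreducible (p j))
    (hcop : Pairwise (Function.onFun IsCoprime p)) (l : Fin r → ℕ) :
    ({T : V →ₗ[F] V | ∀ j, primeCorank (p j) (Module.AEval' T) = l j}.ncard : ℝ) /
        Nat.card (V →ₗ[F] V) =
      ∑' i : Fin r → ℕ, (∏ j, invCoeff ((Nat.card F : ℝ) ^ (p j).natDegree) (l j) (i j)) *
        genDensity (Nat.card F) (Module.finrank F V) (∑ j, (l j + i j) * (p j).natDegree) := by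
  classical
  have : Finite (V →ₗ[F] V) := Finite.of_injective _ DFunLike.coe_injective
  have := Fintype.ofFinite (V →ₗ[F] V)
  have (T : V →ₗ[F] V) : Finite (Module.AEval' T) := Finite.of_equiv _ (Module.AEval'.of T).toEquiv
  set n := Module.finrank F V with hn
  set Q : Fin r → ℝ := fun j => (Nat.card F : ℝ) ^ (p j).natDegree
  have hQ (j : Fin r) : 1 < Q j := one_lt_card_pow_natDegree (hp j)
  set s := Fintype.piFinset fun _ : Fin r => Finset.range (n + 1)
  -- A term outside of the box `s` has a moment at a module of dimension larger than `n`.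
  rw [tsum_eq_sum (s := s)]
  swap
  · intro i hi
    rw [Fintype.mem_piFinset] at hi
    push Not at hi
    obtain ⟨j, hj⟩ := hi
    rw [genDensity_eq_zero, mul_zero]
    refine lt_of_lt_of_le ?_ (Finset.single_le_sum (fun _ _ => Nat.zero_le _) (Finset.mem_univ j))
    rw [Finset.mem_range, not_lt] at hj
    have := Nat.le_mul_of_pos_right (l j + i j) (hp j).natDegree_pos
    omega
  have hind (T : V →ₗ[F] V) :
      (if ∀ j, primeCorank (p j) (Module.AEval' T) = l j then (1 : ℝ) else 0) =
        ∑ i ∈ s, (∏ j, invCoeff (Q j) (l j) (i j)) *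
          Nat.card {f : Module.AEval' T →ₗ[F[X]]
            (∀ j, Fin (l j + i j) → F[X] ⧸ Ideal.span {p j}) // Function.Surjective f} := by
    simp_rw [card_surjective_pi hp hcop, ← Finset.prod_mul_distrib]
    rw [← Finset.prod_univ_sum (fun _ => Finset.range (n + 1)) fun j i =>
      invCoeff (Q j) (l j) i * qDesc (Q j) (primeCorank (p j) (Module.AEval' T)) (l j + i)]
    rw [Finset.prod_congr rfl fun j _ =>
      sum_invCoeff_mul_qDesc (hQ j) (l j) (primeCorank_le_finrank (hp j) T), Finset.prod_ite_zero]
    simp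
  have hcount : ({T : V →ₗ[F] V | ∀ j, primeCorank (p j) (Module.AEval' T) = l j}.ncard : ℝ) =
      ∑ T : V →ₗ[F] V, if ∀ j, primeCorank (p j) (Module.AEval' T) = l j then (1 : ℝ) else 0 := by
    rw [Finset.sum_boole, Set.ncard_eq_toFinset_card', Set.toFinset_ofPred]
  have h0 : (Nat.card (V →ₗ[F] V) : ℝ) ≠ 0 := by exact_mod_cast Nat.card_pos.ne'
  rw [hcount, div_eq_iff h0, Finset.sum_congr rfl fun T _ => hind T, Finset.sum_comm,
    Finset.sum_mul]
  refine Finset.sum_congr rfl fun i _ => ?_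
  have (j : Fin r) : Finite (F[X] ⧸ Ideal.span {p j}) := finite_quotient_span (hp j).ne_zero
  have (j : Fin r) : Module.Finite F (F[X] ⧸ Ideal.span {p j}) := Module.Finite.of_finite
  have hfin : Module.finrank F (∀ j, Fin (l j + i j) → F[X] ⧸ Ideal.span {p j}) =
      ∑ j, (l j + i j) * (p j).natDegree := by
    rw [Module.finrank_pi_fintype]
    refine Finset.sum_congr rfl fun j _ => ?_
    rw [Module.finrank_pi_fintype, Finset.sum_const, finrank_quotient_span_eq_natDegree]
    simp
  rw [← Finset.mul_sum, sum_card_surjective_aeval, hfin]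
  ring

theorem tendsto_ncard_primeCorank (hp : ∀ j, Irreducible (p j))
    (hcop : Pairwise (Function.onFun IsCoprime p)) (l : Fin r → ℕ) :
    Tendsto (fun n : ℕ => ({T : (Fin n → F) →ₗ[F] (Fin n → F) |
        ∀ j, primeCorank (p j) (Module.AEval' T) = l j}.ncard : ℝ) /
          Nat.card ((Fin n → F) →ₗ[F] (Fin n → F))) atTop
      (𝓝 (∏ j, ∑' i, invCoeff ((Nat.card F : ℝ) ^ (p j).natDegree) (l j) i)) := by
  simp_rw [ncard_primeCorank_eq_tsum hp hcop l, Module.finrank_fin_fun]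
  obtain ⟨hs, ht⟩ := summable_and_tsum_prod_pi
    (fun j => invCoeff ((Nat.card F : ℝ) ^ (p j).natDegree) (l j))
    fun j => summable_norm_invCoeff (one_lt_card_pow_natDegree (hp j)) (l j)
  rw [← ht]
  refine tendsto_tsum_of_dominated_convergence hs (fun i => ?_)
    (Eventually.of_forall fun n i => ?_)
  · simpa using (tendsto_genDensity one_lt_natCast_card
      (∑ j, (l j + i j) * (p j).natDegree)).const_mul
        (∏ j, invCoeff ((Nat.card F : ℝ) ^ (p j).natDegree) (l j) (i j))
  · rw [norm_mul]
    exact mul_le_of_le_one_right (norm_nonneg _) (abs_genDensity_le_one one_lt_natCast_card _ _)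

end Moments

/-! ### Matrices with a given cokernel over a finite local principal ring -/

/-- Multiplication by `π` on a finite module has kernel and cokernel of the same size. -/
theorem card_quotient_span_singleton_smul_top {S M : Type*} [CommRing S] [AddCommGroup M]
    [Module S M] [Finite M] (π : S) :
    Nat.card (M ⧸ Ideal.span {π} • (⊤ : Submodule S M)) = Nat.card {x : M // π • x = 0} := by
  let f : M →ₗ[S] M := LinearMap.lsmul S M π
  have h1 : Ideal.span {π} • (⊤ : Submodule S M) = LinearMap.range f := by
    rw [Submodule.ideal_span_singleton_smul]
    ext x
    simp [Submodule.mem_smul_pointwise_iff_exists, f]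
  have h2 := Submodule.card_eq_card_quotient_mul_card (LinearMap.ker f)
  have h3 := Submodule.card_eq_card_quotient_mul_card (LinearMap.range f)
  rw [Nat.card_congr f.quotKerEquivRange.toEquiv, h3, mul_comm] at h2
  rw [h1]
  exact Nat.eq_of_mul_eq_mul_right Nat.card_pos h2

section Submodule

variable {S K : Type*} [CommRing S] [AddCommGroup K] [Module S K]

/-- Families generating a submodule, as families in that submodule. -/
def Submodule.spanEqEquiv (n : ℕ) (N : Submodule S K) :
    {v : Fin n → K // Submodule.span S (Set.range v) = N} ≃
      {w : Fin n → N // Submodule.span S (Set.range w) = ⊤} where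
  toFun v := ⟨fun i => ⟨v.1 i, v.2.le (Submodule.subset_span ⟨i, rfl⟩)⟩, by
    have h : N.subtype '' Set.range (fun i =>
        (⟨v.1 i, v.2.le (Submodule.subset_span ⟨i, rfl⟩)⟩ : N)) = Set.range v.1 := by
      rw [← Set.range_comp]
      rfl
    refine Submodule.map_injective_of_injective N.injective_subtype ?_
    rw [Submodule.map_span, h, v.2, Submodule.map_top, Submodule.range_subtype]⟩
  invFun w := ⟨fun i => w.1 i, by
    have h : Set.range (fun i => (w.1 i : K)) = N.subtype '' Set.range w.1 := by
      rw [← Set.range_comp]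
      rfl
    rw [h, ← Submodule.map_span, w.2, Submodule.map_top, Submodule.range_subtype]⟩
  left_inv _ := rfl
  right_inv _ := rfl

end Submodule

section FiniteLocal

variable {S : Type*} [CommRing S] [IsLocalRing S] [Finite S]
variable {H : Type*} [AddCommGroup H] [Module S H]

/-- The kernel of a homomorphism from `Sⁿ` to `H` needs exactly `n` generators. -/
theorem card_quotient_ker {π : S} (hπ : maximalIdeal S = Ideal.span {π})
    (hann : ∀ s : S, π * s = 0 → ∀ x : H, s • x = 0) {n : ℕ} (φ : (Fin n → S) →ₗ[S] H) :
    Nat.card (LinearMap.ker φ ⧸ maximalIdeal S • (⊤ : Submodule S (LinearMap.ker φ))) =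
      Nat.card (ResidueField S) ^ n := by
  -- Both sides count elements killed by `π`, and all those of `Sⁿ` lie in the kernel.
  have hres : Nat.card (ResidueField S) = Nat.card {s : S // π * s = 0} := by
    have h := card_quotient_span_singleton_smul_top (M := S) π
    rw [smul_eq_mul, Ideal.mul_top, ← hπ] at h
    exact h
  have hpow : Nat.card {s : S // π * s = 0} ^ n = Nat.card (Fin n → {s : S // π * s = 0}) := by
    rw [Nat.card_fun, Nat.card_fin]
  rw [hπ, card_quotient_span_singleton_smul_top, hres, hpow]
  have hmem (x : Fin n → S) (hx : ∀ i, π * x i = 0) : x ∈ LinearMap.ker φ := by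
    rw [LinearMap.mem_ker, ← (Pi.basisFun S (Fin n)).sum_repr x, map_sum]
    exact Finset.sum_eq_zero fun i _ => by
      rw [map_smul]
      exact hann _ (hx i) _
  exact Nat.card_congr
    { toFun := fun x i => ⟨x.1.1 i, congrFun (congrArg Subtype.val x.2) i⟩
      invFun := fun y => ⟨⟨fun i => (y i).1, hmem _ fun i => (y i).2⟩,
        Subtype.ext (funext fun i => (y i).2)⟩
      left_inv := fun x => rfl
      right_inv := fun y => rfl }

/-- A matrix together with an isomorphism of its cokernel with `H` is the same thing as a
surjection to `H` together with a matrix whose image is the kernel of that surjection. -/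
noncomputable def cokerIsoEquiv (S H : Type*) [CommRing S] [AddCommGroup H] [Module S H] (n : ℕ) :
    (Σ A : Matrix (Fin n) (Fin n) S, A.coker ≃ₗ[S] H) ≃
      Σ φ : {φ : (Fin n → S) →ₗ[S] H // Function.Surjective φ},
        {A : Matrix (Fin n) (Fin n) S // LinearMap.range A.mulVecLin = LinearMap.ker φ.1} where
  toFun x := ⟨⟨x.2.toLinearMap ∘ₗ Submodule.mkQ _,
    x.2.surjective.comp (Submodule.mkQ_surjective _)⟩, x.1, by
      rw [LinearMap.ker_comp, LinearEquiv.ker, Submodule.comap_bot, Submodule.ker_mkQ]⟩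
  invFun y := ⟨y.2.1, (Submodule.quotEquivOfEq _ _ y.2.2).trans
    (y.1.1.quotKerEquivOfSurjective y.1.2)⟩
  left_inv x := by
    refine Sigma.ext rfl (heq_of_eq (LinearEquiv.ext fun z => ?_))
    obtain ⟨z, rfl⟩ := Submodule.mkQ_surjective _ z
    rfl
  right_inv y := by
    obtain ⟨⟨φ, hφ⟩, A, hA⟩ := y
    rfl

theorem card_range_eq {n : ℕ} (N : Submodule S (Fin n → S)) {d : ℕ}
    (hd : Nat.card (N ⧸ maximalIdeal S • (⊤ : Submodule S N)) = Nat.card (ResidueField S) ^ d) :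
    (Nat.card {A : Matrix (Fin n) (Fin n) S // LinearMap.range A.mulVecLin = N} : ℝ) =
      (Nat.card N : ℝ) ^ n * genDensity (Nat.card (ResidueField S)) n d := by
  rw [← card_span_eq_top_of_isLocalRing hd n, ← Nat.card_congr (Submodule.spanEqEquiv n N)]
  congr 1
  let e : Matrix (Fin n) (Fin n) S ≃ (Fin n → Fin n → S) := Equiv.piComm fun _ _ => S
  refine Nat.card_congr (e.subtypeEquiv fun A => ?_)
  rw [Matrix.range_mulVecLin]
  rfl

theorem card_surjective_eq [Finite H] {d : ℕ}
    (hd : Nat.card (H ⧸ maximalIdeal S • (⊤ : Submodule S H)) = Nat.card (ResidueField S) ^ d)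
    (n : ℕ) :
    (Nat.card {φ : (Fin n → S) →ₗ[S] H // Function.Surjective φ} : ℝ) =
      (Nat.card H : ℝ) ^ n * genDensity (Nat.card (ResidueField S)) n d := by
  rw [← card_span_eq_top_of_isLocalRing hd n]
  congr 1
  refine Nat.card_congr (((Pi.basisFun S (Fin n)).constr ℕ).symm.toEquiv.subtypeEquiv fun f => ?_)
  obtain ⟨g, rfl⟩ := ((Pi.basisFun S (Fin n)).constr ℕ (M' := H)).surjective f
  rw [← LinearMap.range_eq_top, Module.Basis.constr_range]
  simp

/-- The proportion of matrices with cokernel isomorphic to `H` over a finite local principal ring,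
when `H` is killed by the annihilator of the maximal ideal. -/
theorem ncard_coker_mul_card_aut [Finite H] {π : S} (hπ : maximalIdeal S = Ideal.span {π})
    (hann : ∀ s : S, π * s = 0 → ∀ x : H, s • x = 0) {d : ℕ}
    (hd : Nat.card (H ⧸ maximalIdeal S • (⊤ : Submodule S H)) = Nat.card (ResidueField S) ^ d)
    (n : ℕ) :
    ({A : Matrix (Fin n) (Fin n) S | Nonempty (A.coker ≃ₗ[S] H)}.ncard : ℝ) *
        Nat.card (H ≃ₗ[S] H) =
      Nat.card (Matrix (Fin n) (Fin n) S) * (genDensity (Nat.card (ResidueField S)) n d *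
        genDensity (Nat.card (ResidueField S)) n n) := by
  classical
  have := Fintype.ofFinite (Matrix (Fin n) (Fin n) S)
  have : Finite ((Fin n → S) →ₗ[S] H) := Finite.of_injective _ DFunLike.coe_injective
  have := Fintype.ofFinite {φ : (Fin n → S) →ₗ[S] H // Function.Surjective φ}
  have (A : Matrix (Fin n) (Fin n) S) : Finite (A.coker ≃ₗ[S] H) := by
    have : Finite A.coker := Finite.of_surjective _ (Submodule.mkQ_surjective _)
    exact Finite.of_injective _ DFunLike.coe_injective
  have h1 : Nat.card (Σ A : Matrix (Fin n) (Fin n) S, A.coker ≃ₗ[S] H) =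
      {A : Matrix (Fin n) (Fin n) S | Nonempty (A.coker ≃ₗ[S] H)}.ncard *
        Nat.card (H ≃ₗ[S] H) := by
    have hterm (A : Matrix (Fin n) (Fin n) S) : Nat.card (A.coker ≃ₗ[S] H) =
        if Nonempty (A.coker ≃ₗ[S] H) then Nat.card (H ≃ₗ[S] H) else 0 := by
      split_ifs with h
      · obtain ⟨e⟩ := h
        exact Nat.card_congr
          { toFun := fun f => e.symm.trans f
            invFun := fun f => e.trans f
            left_inv := fun f => by ext; simp
            right_inv := fun f => by ext; simp }
      · rw [not_nonempty_iff] at h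
        exact Nat.card_of_isEmpty
    rw [Nat.card_sigma, Finset.sum_congr rfl fun A _ => hterm A, ← Finset.sum_filter,
      Finset.sum_const, smul_eq_mul, Set.ncard_eq_toFinset_card', Set.toFinset_ofPred]
  have hH0 : (Nat.card H : ℝ) ≠ 0 := by exact_mod_cast Nat.card_pos.ne'
  have h2 (φ : {φ : (Fin n → S) →ₗ[S] H // Function.Surjective φ}) :
      (Nat.card {A : Matrix (Fin n) (Fin n) S //
        LinearMap.range A.mulVecLin = LinearMap.ker φ.1} : ℝ) =
      Nat.card (Matrix (Fin n) (Fin n) S) / (Nat.card H : ℝ) ^ n *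
        genDensity (Nat.card (ResidueField S)) n n := by
    rw [card_range_eq _ (card_quotient_ker hπ hann φ.1)]
    congr 1
    have h3 := Submodule.card_eq_card_quotient_mul_card (LinearMap.ker φ.1)
    rw [Nat.card_congr (φ.1.quotKerEquivOfSurjective φ.2).toEquiv] at h3
    have h4 : Nat.card (Matrix (Fin n) (Fin n) S) = Nat.card (Fin n → S) ^ n := by
      rw [Matrix, Nat.card_fun, Nat.card_fin]
    rw [h4, eq_div_iff (pow_ne_zero _ hH0), ← mul_pow, h3]
    push_cast
    ring
  have h5 : (Nat.card (Σ A : Matrix (Fin n) (Fin n) S, A.coker ≃ₗ[S] H) : ℝ) =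
      Nat.card {φ : (Fin n → S) →ₗ[S] H // Function.Surjective φ} *
        (Nat.card (Matrix (Fin n) (Fin n) S) / (Nat.card H : ℝ) ^ n *
          genDensity (Nat.card (ResidueField S)) n n) := by
    rw [Nat.card_congr (cokerIsoEquiv S H n), Nat.card_sigma, Nat.cast_sum,
      Finset.sum_congr rfl fun φ _ => h2 φ, Finset.sum_const, Finset.card_univ, nsmul_eq_mul,
      ← Nat.card_eq_fintype_card]
  rw [h1, Nat.cast_mul] at h5
  rw [h5, card_surjective_eq hd]
  field_simp

end FiniteLocal

/-! ### Cokernel and reduction to the residue field -/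

theorem Matrix.exists_isUnit_mul_mul_eq_of_rank_eq {F : Type*} [Field F] {n : ℕ}
    {X Y : Matrix (Fin n) (Fin n) F} (h : X.rank = Y.rank) :
    ∃ U V : Matrix (Fin n) (Fin n) F, IsUnit U ∧ IsUnit V ∧ U * X * V = Y := by
  obtain ⟨V, U, e, ⟨V, rfl⟩, ⟨U, rfl⟩, hX⟩ := X.exists_rank_normal_form
  obtain ⟨V', U', e', ⟨V', rfl⟩, ⟨U', rfl⟩, hY⟩ := Y.exists_rank_normal_form
  obtain ⟨k, hk⟩ : ∃ k, X.rank = k := ⟨_, rfl⟩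
  rw [hk] at h
  revert e e'
  rw [hk, ← h]
  intro e hX e' hY
  set J : Matrix (Fin k ⊕ Fin (Fintype.card (Fin n) - k))
    (Fin k ⊕ Fin (Fintype.card (Fin n) - k)) F := fromBlocks 1 0 0 0
  -- The two normal forms differ by a permutation of the basis.
  let σ : Equiv.Perm (Fin n) := e'.trans e.symm
  let W : Matrix (Fin n) (Fin n) F := (1 : Matrix (Fin n) (Fin n) F).submatrix σ id
  let W' : Matrix (Fin n) (Fin n) F := (1 : Matrix (Fin n) (Fin n) F).submatrix id σ
  have hσ : W * (J.submatrix e e) * W' = J.submatrix e' e' := by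
    have h1 : W * (J.submatrix e e) = J.submatrix e' e := by
      ext i j
      simp [W, Matrix.mul_apply, Matrix.one_apply, σ]
    rw [h1]
    ext i j
    simp [W', Matrix.mul_apply, Matrix.one_apply, σ]
  have hWW' : W * W' = 1 := by
    ext i j
    simp [W, W', Matrix.mul_apply, Matrix.one_apply]
  have hW : IsUnit W := IsUnit.of_mul_eq_one _ hWW'
  have hW' : IsUnit W' := IsUnit.of_mul_eq_one_right _ hWW'
  refine ⟨V'⁻¹.val * W * V.val, U.val * W' * U'⁻¹.val, (V'⁻¹.isUnit.mul hW).mul V.isUnit,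
    (U.isUnit.mul hW').mul U'⁻¹.isUnit, ?_⟩
  have h2 : V'⁻¹.val * W * V.val * X * (U.val * W' * U'⁻¹.val) =
      V'⁻¹.val * (W * (V.val * X * U.val) * W') * U'⁻¹.val := by
    simp only [Matrix.mul_assoc]
  rw [h2, hX, hσ, ← hY]
  simp only [Matrix.mul_assoc]
  rw [Units.mul_inv, Matrix.mul_one, Units.inv_mul_cancel_left]

theorem Matrix.rank_eq_of_card_coker_eq {F : Type*} [Field F] [Finite F] {n : ℕ}
    {X Y : Matrix (Fin n) (Fin n) F} (h : Nat.card X.coker = Nat.card Y.coker) :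
    X.rank = Y.rank := by
  have h1 (Z : Matrix (Fin n) (Fin n) F) :
      Nat.card (Fin n → F) = Nat.card F ^ Z.rank * Nat.card Z.coker := by
    rw [Submodule.card_eq_card_quotient_mul_card (LinearMap.range Z.mulVecLin),
      Module.natCard_eq_pow_finrank (K := F) (V := LinearMap.range Z.mulVecLin)]
    rfl
  have h2 := h1 X
  have : Finite Y.coker := Finite.of_surjective _ (Submodule.mkQ_surjective _)
  rw [h1 Y, h] at h2
  exact Nat.pow_right_injective Finite.one_lt_card (Nat.eq_of_mul_eq_mul_right Nat.card_pos h2.symm)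

theorem Matrix.nonempty_coker_linearEquiv {S : Type*} [CommRing S] {n : ℕ}
    {U V : Matrix (Fin n) (Fin n) S} (hU : IsUnit U) (hV : IsUnit V)
    (A : Matrix (Fin n) (Fin n) S) : Nonempty ((U * A * V).coker ≃ₗ[S] A.coker) := by
  obtain ⟨U, rfl⟩ := hU
  obtain ⟨V, rfl⟩ := hV
  let e : (Fin n → S) ≃ₗ[S] (Fin n → S) := Matrix.toLin'OfInv U.inv_mul U.mul_inv
  have hV : LinearMap.range (V : Matrix (Fin n) (Fin n) S).mulVecLin = ⊤ :=
    LinearMap.range_eq_top.mpr (Matrix.toLin'OfInv V.inv_mul V.mul_inv).surjective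
  refine ⟨(Submodule.Quotient.equiv _ _ e ?_).symm⟩
  rw [Matrix.mulVecLin_mul, Matrix.mulVecLin_mul, LinearMap.range_comp_of_range_eq_top _ hV,
    LinearMap.range_comp]
  rfl

section Reduction

variable {S F : Type*} [CommRing S] [IsLocalRing S] [Field F] {ρ : S →+* F}

theorem ker_eq_maximalIdeal (hρ : Function.Surjective ρ) : RingHom.ker ρ = maximalIdeal S :=
  IsLocalRing.eq_maximalIdeal (RingHom.ker_isMaximal_of_surjective ρ hρ)

theorem natCard_residueField (hρ : Function.Surjective ρ) :
    Nat.card (ResidueField S) = Nat.card F :=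
  Nat.card_congr ((Ideal.quotEquivOfEq (ker_eq_maximalIdeal hρ).symm).trans
    (RingHom.quotientKerEquivOfSurjective hρ)).toEquiv

theorem Matrix.isUnit_map_iff (hρ : Function.Surjective ρ) {n : ℕ}
    (A : Matrix (Fin n) (Fin n) S) : IsUnit (A.map ρ) ↔ IsUnit A := by
  have h : (A.map ρ).det = ρ A.det := (RingHom.map_det ρ A).symm
  rw [Matrix.isUnit_iff_isUnit_det, Matrix.isUnit_iff_isUnit_det A, h, isUnit_iff_ne_zero, Ne,
    ← RingHom.mem_ker, ker_eq_maximalIdeal hρ, IsLocalRing.mem_maximalIdeal, mem_nonunits_iff,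
    not_not]

theorem Matrix.exists_map_eq {S F : Type*} {ρ : S → F} (hρ : Function.Surjective ρ) {n : ℕ}
    (X : Matrix (Fin n) (Fin n) F) : ∃ A : Matrix (Fin n) (Fin n) S, A.map ρ = X :=
  ⟨X.map (Function.surjInv hρ), by
    ext i j
    simp [Function.surjInv_eq hρ]⟩

variable {H : Type*} [AddCommGroup H] [Module S H]

/-- The cokernel of the reduction of a matrix is the reduction of the cokernel. -/
theorem Matrix.card_coker_map (hρ : Function.Surjective ρ) {n : ℕ}
    {A : Matrix (Fin n) (Fin n) S} (e : A.coker ≃ₗ[S] H) :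
    Nat.card (A.map ρ).coker = Nat.card (H ⧸ maximalIdeal S • (⊤ : Submodule S H)) := by
  let φ : (Fin n → S) →ₗ[S] H := e.toLinearMap ∘ₗ Submodule.mkQ _
  have hφ : Function.Surjective φ := e.surjective.comp (Submodule.mkQ_surjective _)
  have hker : LinearMap.ker φ = LinearMap.range A.mulVecLin := by
    rw [LinearMap.ker_comp, LinearEquiv.ker, Submodule.comap_bot, Submodule.ker_mkQ]
  let g : (Fin n → S) →+ H ⧸ maximalIdeal S • (⊤ : Submodule S H) :=
    (Submodule.mkQ _ ∘ₗ φ).toAddMonoidHom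
  let f : (Fin n → S) →+ (A.map ρ).coker :=
    (Submodule.mkQ (LinearMap.range (A.map ρ).mulVecLin)).toAddMonoidHom.comp
      (ρ.toAddMonoidHom.compLeft (Fin n))
  have hg : Function.Surjective g := (Submodule.mkQ_surjective _).comp hφ
  have hcomp : Function.Surjective (ρ.toAddMonoidHom.compLeft (Fin n)) := hρ.comp_left
  have hf : Function.Surjective f := (Submodule.mkQ_surjective _).comp hcomp
  have hmap (y : Fin n → S) : ρ ∘ (A.mulVec y) = (A.map ρ).mulVec (ρ ∘ y) :=
    funext fun i => RingHom.map_mulVec ρ A y i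
  have hsmul (z : Fin n → S) :
      z ∈ maximalIdeal S • (⊤ : Submodule S (Fin n → S)) ↔ ρ ∘ z = 0 := by
    rw [← ker_eq_maximalIdeal hρ]
    constructor
    · intro hz
      refine Submodule.smul_induction_on hz (fun a ha x _ => ?_) fun x y hx hy => ?_
      · ext i
        simp [(RingHom.mem_ker).mp ha]
      · ext i
        have h1 := congrFun hx i
        have h2 := congrFun hy i
        simp_all
    · intro hz
      rw [← (Pi.basisFun S (Fin n)).sum_repr z]
      exact Submodule.sum_mem _ fun i _ => Submodule.smul_mem_smul
        (RingHom.mem_ker.mpr (congrFun hz i)) trivial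
  have hkers : f.ker = g.ker := by
    ext x
    have hgx : x ∈ g.ker ↔
        x ∈ maximalIdeal S • (⊤ : Submodule S (Fin n → S)) ⊔ LinearMap.range A.mulVecLin := by
      rw [← hker, ← Submodule.comap_map_eq, Submodule.map_smul'', Submodule.map_top,
        LinearMap.range_eq_top.mpr hφ, Submodule.mem_comap, AddMonoidHom.mem_ker]
      exact Submodule.Quotient.mk_eq_zero _
    have hfx : x ∈ f.ker ↔ ρ ∘ x ∈ LinearMap.range (A.map ρ).mulVecLin :=
      (AddMonoidHom.mem_ker).trans (Submodule.Quotient.mk_eq_zero _)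
    rw [hfx, hgx, Submodule.mem_sup]
    constructor
    · rintro ⟨w, hw⟩
      obtain ⟨y, rfl⟩ := hcomp w
      refine ⟨x - A.mulVec y, (hsmul _).mpr ?_, A.mulVec y, ⟨y, rfl⟩, sub_add_cancel _ _⟩
      have h3 : ρ ∘ (x - A.mulVec y) = ρ ∘ x - ρ ∘ (A.mulVec y) := by
        ext i
        simp
      rw [h3, hmap, sub_eq_zero]
      exact hw.symm
    · rintro ⟨z, hz, _, ⟨y, rfl⟩, rfl⟩
      refine ⟨ρ ∘ y, ?_⟩
      have h3 : ρ ∘ (z + A.mulVecLin y) = ρ ∘ z + ρ ∘ (A.mulVec y) := by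
        ext i
        simp
      rw [h3, (hsmul z).mp hz, zero_add, hmap]
      rfl
  rw [← Nat.card_congr (QuotientAddGroup.quotientKerEquivOfSurjective f hf).toEquiv,
    ← Nat.card_congr (QuotientAddGroup.quotientKerEquivOfSurjective g hg).toEquiv, hkers]

/-- The number of matrices with given cokernel above a matrix `X` over the residue field depends
only on the corank of `X`. -/
theorem ncard_coker_fiber_eq (hρ : Function.Surjective ρ) {n : ℕ}
    {X Y : Matrix (Fin n) (Fin n) F} (h : X.rank = Y.rank) :
    {A : Matrix (Fin n) (Fin n) S | Nonempty (A.coker ≃ₗ[S] H) ∧ A.map ρ = X}.ncard =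
      {A : Matrix (Fin n) (Fin n) S | Nonempty (A.coker ≃ₗ[S] H) ∧ A.map ρ = Y}.ncard := by
  obtain ⟨U, V, hU, hV, rfl⟩ := Matrix.exists_isUnit_mul_mul_eq_of_rank_eq h
  obtain ⟨U, rfl⟩ := Matrix.exists_map_eq hρ U
  obtain ⟨V, rfl⟩ := Matrix.exists_map_eq hρ V
  have hU' := hU
  have hV' := hV
  rw [Matrix.isUnit_map_iff hρ] at hU hV
  have hbij : Function.Bijective fun A : Matrix (Fin n) (Fin n) S => U * A * V := by
    obtain ⟨u, rfl⟩ := hU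
    obtain ⟨v, rfl⟩ := hV
    exact (v.mulRight.bijective).comp (u.mulLeft.bijective)
  rw [← Set.ncard_image_of_injective _ hbij.injective]
  congr 1
  ext B
  constructor
  · rintro ⟨A, ⟨⟨e⟩, rfl⟩, rfl⟩
    exact ⟨⟨(Matrix.nonempty_coker_linearEquiv hU hV A).some.trans e⟩, by
      simp [Matrix.map_mul]⟩
  · rintro ⟨⟨e⟩, hB⟩
    obtain ⟨A, rfl⟩ := hbij.surjective B
    refine ⟨A, ⟨⟨(Matrix.nonempty_coker_linearEquiv hU hV A).some.symm.trans e⟩, ?_⟩, rfl⟩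
    simp only [Matrix.map_mul] at hB
    exact hU'.mul_left_cancel (hV'.mul_right_cancel hB)

/-- Among the matrices with cokernel `H`, the reduction to the residue field is uniformly
distributed on the matrices of the corank given by `H`. -/
theorem ncard_coker_inter_mul [Finite S] (hρ : Function.Surjective ρ) {n c : ℕ}
    (hc : Nat.card (H ⧸ maximalIdeal S • (⊤ : Submodule S H)) = c)
    (T : Set (Matrix (Fin n) (Fin n) F)) :
    {A : Matrix (Fin n) (Fin n) S | Nonempty (A.coker ≃ₗ[S] H) ∧ A.map ρ ∈ T}.ncard *
        {X : Matrix (Fin n) (Fin n) F | Nat.card X.coker = c}.ncard =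
      {A : Matrix (Fin n) (Fin n) S | Nonempty (A.coker ≃ₗ[S] H)}.ncard *
        {X : Matrix (Fin n) (Fin n) F | X ∈ T ∧ Nat.card X.coker = c}.ncard := by
  classical
  have : Finite F := Finite.of_surjective ρ hρ
  have := Fintype.ofFinite (Matrix (Fin n) (Fin n) F)
  have := Fintype.ofFinite (Matrix (Fin n) (Fin n) S)
  by_cases hne : ∃ X₀ : Matrix (Fin n) (Fin n) F, Nat.card X₀.coker = c
  · obtain ⟨X₀, hX₀⟩ := hne
    set a := {A : Matrix (Fin n) (Fin n) S | Nonempty (A.coker ≃ₗ[S] H) ∧ A.map ρ = X₀}.ncard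
    have key (T : Set (Matrix (Fin n) (Fin n) F)) :
        {A : Matrix (Fin n) (Fin n) S | Nonempty (A.coker ≃ₗ[S] H) ∧ A.map ρ ∈ T}.ncard =
          {X : Matrix (Fin n) (Fin n) F | X ∈ T ∧ Nat.card X.coker = c}.ncard * a := by
      rw [Set.ncard_eq_toFinset_card', Set.ncard_eq_toFinset_card',
        Finset.card_eq_sum_card_fiberwise (f := fun A => A.map ρ)
          (t := {X : Matrix (Fin n) (Fin n) F | X ∈ T ∧ Nat.card X.coker = c}.toFinset),
        Finset.sum_const_nat]
      · intro X hX
        rw [Set.mem_toFinset] at hX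
        have hfib : {A : Matrix (Fin n) (Fin n) S |
            Nonempty (A.coker ≃ₗ[S] H) ∧ A.map ρ = X}.ncard = a :=
          ncard_coker_fiber_eq hρ (Matrix.rank_eq_of_card_coker_eq (hX.2.trans hX₀.symm))
        rw [← hfib, Set.ncard_eq_toFinset_card']
        congr 1
        ext A
        simp only [Finset.mem_filter, Set.mem_toFinset, Set.mem_ofPred_eq]
        constructor
        · rintro ⟨⟨h1, -⟩, h2⟩
          exact ⟨h1, h2⟩
        · rintro ⟨h1, rfl⟩
          exact ⟨⟨h1, hX.1⟩, rfl⟩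
      · intro A hA
        rw [Finset.mem_coe, Set.mem_toFinset] at hA ⊢
        exact ⟨hA.2, (Matrix.card_coker_map hρ hA.1.some).trans hc⟩
    have h1 := key T
    have h2 := key Set.univ
    simp only [Set.mem_univ, and_true, true_and] at h2
    rw [h1, h2]
    ring
  · have h1 : {X : Matrix (Fin n) (Fin n) F | Nat.card X.coker = c} = ∅ :=
      Set.eq_empty_of_forall_notMem fun X hX => hne ⟨X, hX⟩
    have h2 : {X : Matrix (Fin n) (Fin n) F | X ∈ T ∧ Nat.card X.coker = c} = ∅ :=
      Set.eq_empty_of_forall_notMem fun X hX => hne ⟨X, hX.2⟩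
    rw [h1, h2]
    simp

end Reduction

/-! ### Haar measure and finite quotients -/

/-- Under a homomorphism with open kernel to a finite group, an invariant probability measure is
mapped to the uniform distribution. -/
theorem toReal_measure_preimage {G K : Type*} [AddCommGroup G] [TopologicalSpace G]
    [IsTopologicalAddGroup G] [MeasurableSpace G] [BorelSpace G] (μ : Measure G)
    [μ.IsAddLeftInvariant] [IsProbabilityMeasure μ] [AddCommGroup K] [Finite K] (f : G →+ K)
    (hf : Function.Surjective f) (hker : IsOpen (f.ker : Set G)) (T : Set K) :
    MeasurableSet (f ⁻¹' T) ∧ (μ (f ⁻¹' T)).toReal = T.ncard / Nat.card K := by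
  classical
  have := Fintype.ofFinite K
  have hfib (t : K) : ∃ x₀, f ⁻¹' {t} = (fun x => -x₀ + x) ⁻¹' (f.ker : Set G) := by
    obtain ⟨x₀, rfl⟩ := hf t
    refine ⟨x₀, Set.ext fun x => ?_⟩
    rw [Set.mem_preimage, Set.mem_preimage, SetLike.mem_coe, AddMonoidHom.mem_ker, map_add,
      map_neg, neg_add_eq_zero, Set.mem_singleton_iff, eq_comm]
  have hmeas (t : K) : MeasurableSet (f ⁻¹' {t}) := by
    obtain ⟨x₀, h⟩ := hfib t
    rw [h]
    exact (hker.preimage (continuous_const_add _)).measurableSet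
  have hval (t : K) : μ (f ⁻¹' {t}) = μ f.ker := by
    obtain ⟨x₀, h⟩ := hfib t
    rw [h, measure_preimage_add]
  have hunion (T : Set K) : f ⁻¹' T = ⋃ t ∈ T.toFinset, f ⁻¹' {t} := by
    ext x
    simp
  have hsum (T : Set K) : μ (f ⁻¹' T) = T.ncard * μ f.ker := by
    rw [hunion T, measure_biUnion_finset (fun s _ t _ hst =>
      (Set.disjoint_singleton.mpr hst).preimage f) fun t _ => hmeas t,
      Finset.sum_congr rfl fun t _ => hval t, Finset.sum_const, nsmul_eq_mul,
      Set.ncard_eq_toFinset_card']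
  refine ⟨?_, ?_⟩
  · rw [hunion T]
    exact Finset.measurableSet_biUnion _ fun t _ => hmeas t
  · have huniv := congrArg ENNReal.toReal (hsum Set.univ)
    rw [Set.preimage_univ, measure_univ, Set.ncard_univ, ENNReal.toReal_one, ENNReal.toReal_mul,
      ENNReal.toReal_natCast] at huniv
    have h0 : (Nat.card K : ℝ) ≠ 0 := by exact_mod_cast Nat.card_pos.ne'
    rw [hsum T, ENNReal.toReal_mul, ENNReal.toReal_natCast, eq_div_iff h0]
    linear_combination -(T.ncard : ℝ) * huniv

/-- The Haar probability of an event that depends only on the reduction of the matrix modulo a power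
of the maximal ideal is the proportion of matrices in that event over the finite quotient ring. -/
theorem haarMatrix_preimage {R : Type*} [CommRing R] [IsLocalRing R] [IsNoetherianRing R]
    [IsAdicComplete (maximalIdeal R) R] [Finite (ResidueField R)] (n k : ℕ)
    (T : Set (Matrix (Fin n) (Fin n) (R ⧸ maximalIdeal R ^ k))) :
    MeasurableSet[matrixBorel R n]
        ((fun A : Matrix (Fin n) (Fin n) R =>
          A.map (Ideal.Quotient.mk (maximalIdeal R ^ k))) ⁻¹' T) ∧
      (haarMatrix R n ((fun A : Matrix (Fin n) (Fin n) R =>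
        A.map (Ideal.Quotient.mk (maximalIdeal R ^ k))) ⁻¹' T)).toReal =
          T.ncard / Nat.card (Matrix (Fin n) (Fin n) (R ⧸ maximalIdeal R ^ k)) := by
  let := (maximalIdeal R).adicTopology
  let := matrixBorel R n
  have : BorelSpace (Matrix (Fin n) (Fin n) R) := ⟨rfl⟩
  have : IsTopologicalRing R :=
    (maximalIdeal R).adic_basis.toRing_subgroups_basis.toRingFilterBasis.isTopologicalRing
  have : CompactSpace (Matrix (Fin n) (Fin n) R) := compactSpace_matrix R n
  have : Finite (R ⧸ maximalIdeal R) := inferInstanceAs (Finite (ResidueField R))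
  have : Finite (R ⧸ maximalIdeal R ^ k) :=
    Ideal.finite_quotient_pow (IsNoetherian.noetherian (maximalIdeal R)) k
  let μ : Measure (Matrix (Fin n) (Fin n) R) := Measure.addHaarMeasure ⊤
  have : IsProbabilityMeasure μ := ⟨Measure.addHaarMeasure_self⟩
  let f : Matrix (Fin n) (Fin n) R →+ Matrix (Fin n) (Fin n) (R ⧸ maximalIdeal R ^ k) :=
    (Ideal.Quotient.mk (maximalIdeal R ^ k)).toAddMonoidHom.mapMatrix
  have hker : IsOpen (f.ker : Set (Matrix (Fin n) (Fin n) R)) := by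
    have h : (f.ker : Set (Matrix (Fin n) (Fin n) R)) =
        ⋂ i, ⋂ j, (fun A : Matrix (Fin n) (Fin n) R => A i j) ⁻¹'
          (maximalIdeal R ^ k : Ideal R) := by
      ext A
      rw [SetLike.mem_coe, AddMonoidHom.mem_ker]
      simp only [Set.mem_iInter, Set.mem_preimage, SetLike.mem_coe,
        ← Ideal.Quotient.eq_zero_iff_mem]
      exact ⟨fun h i j => congrFun (congrFun h i) j, fun h => by
        ext i j
        exact h i j⟩
    rw [h]
    refine isOpen_iInter_of_finite fun i => isOpen_iInter_of_finite fun j => ?_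
    exact ((maximalIdeal R).openAddSubgroup k).isOpen.preimage (continuous_id.matrix_elem i j)
  exact toReal_measure_preimage μ f
    (Matrix.exists_map_eq (Ideal.Quotient.mk_surjective (I := maximalIdeal R ^ k))) hker T

/-! ### Modules of finite length over a local ring -/

theorem IsFiniteLength.finite_and_exists_pow_smul_eq_zero {R : Type*} [CommRing R] [IsLocalRing R]
    [Finite (ResidueField R)] {H : Type*} [AddCommGroup H] [Module R H] (hH : IsFiniteLength R H) :
    Finite H ∧ ∃ N : ℕ, ∀ a ∈ maximalIdeal R ^ N, ∀ x : H, a • x = 0 := by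
  induction hH with
  | of_subsingleton => exact ⟨inferInstance, 0, fun _ _ _ => Subsingleton.elim _ _⟩
  | @of_simple_quotient M _ _ L hL _ ih =>
    obtain ⟨hfin, N, hN⟩ := ih
    obtain ⟨I, hI, ⟨e⟩⟩ := isSimpleModule_iff_quot_maximal.mp hL
    obtain rfl := IsLocalRing.eq_maximalIdeal hI
    have hq : Finite (R ⧸ maximalIdeal R) := inferInstanceAs (Finite (ResidueField R))
    have : Finite (M ⧸ L) := Finite.of_equiv _ e.symm.toEquiv
    refine ⟨?_, N + 1, fun a ha x => ?_⟩
    · refine Nat.finite_of_card_ne_zero ?_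
      rw [Submodule.card_eq_card_quotient_mul_card L]
      exact mul_ne_zero Nat.card_pos.ne' Nat.card_pos.ne'
    · rw [pow_succ] at ha
      refine Submodule.mul_induction_on ha (fun b hb c hc => ?_) fun b c hb hc => ?_
      · have hcx : c • x ∈ L := by
          rw [← Submodule.Quotient.mk_eq_zero, Submodule.Quotient.mk_smul]
          refine e.injective ?_
          rw [map_smul, map_zero]
          obtain ⟨y, hy⟩ := Ideal.Quotient.mk_surjective (e (Submodule.Quotient.mk x))
          rw [← hy]
          change Ideal.Quotient.mk (maximalIdeal R) (c * y) = 0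
          exact Ideal.Quotient.eq_zero_iff_mem.mpr (Ideal.mul_mem_right y _ hc)
        rw [mul_smul]
        exact congrArg Subtype.val (hN b hb ⟨c • x, hcx⟩)
      · rw [add_smul, hb, hc, add_zero]

/-! ### Cokernels modulo a power of the maximal ideal -/

theorem nonempty_coker_linearEquiv_iff {R H : Type*} [CommRing R] [AddCommGroup H] [Module R H]
    {n : ℕ} (A : Matrix (Fin n) (Fin n) R) :
    Nonempty (A.coker ≃ₗ[R] H) ↔ ∃ w : Fin n → H,
      Function.Surjective (Fintype.linearCombination R w) ∧
        LinearMap.range A.mulVecLin = LinearMap.ker (Fintype.linearCombination R w) := by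
  constructor
  · rintro ⟨e⟩
    let y := cokerIsoEquiv R H n ⟨A, e⟩
    have hy : Fintype.linearCombination R (fun i => y.1.1 (Pi.single i 1)) = y.1.1 := by
      refine LinearMap.pi_ext' fun i => LinearMap.ext_ring ?_
      simp
    refine ⟨fun i => y.1.1 (Pi.single i 1), ?_, ?_⟩
    · rw [hy]
      exact y.1.2
    · rw [hy]
      exact y.2.2
  · rintro ⟨w, hw, hA⟩
    exact ⟨((cokerIsoEquiv R H n).symm ⟨⟨_, hw⟩, A, hA⟩).2⟩

/-- If `𝔪 ^ N` kills `H`, whether the cokernel of a matrix is isomorphic to `H` can be decided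
modulo `𝔪 ^ (N + 1)`. -/
theorem nonempty_coker_map_linearEquiv_iff {R S H : Type*} [CommRing R] [IsLocalRing R]
    [IsNoetherianRing R] [CommRing S] [Algebra R S] [AddCommGroup H] [Module R H] [Module S H]
    [IsScalarTower R S H] (hsurj : Function.Surjective (algebraMap R S)) {N : ℕ}
    (hker : RingHom.ker (algebraMap R S) = maximalIdeal R ^ (N + 1))
    (hN : ∀ a ∈ maximalIdeal R ^ N, ∀ x : H, a • x = 0) {n : ℕ}
    (A : Matrix (Fin n) (Fin n) R) :
    Nonempty ((A.map (algebraMap R S)).coker ≃ₗ[S] H) ↔ Nonempty (A.coker ≃ₗ[R] H) := by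
  rw [nonempty_coker_linearEquiv_iff, nonempty_coker_linearEquiv_iff]
  refine exists_congr fun w => ?_
  have hlc (x : Fin n → R) : Fintype.linearCombination S w (algebraMap R S ∘ x) =
      Fintype.linearCombination R w x := by
    simp [Fintype.linearCombination_apply]
  have hmap (y : Fin n → R) : algebraMap R S ∘ (A.mulVec y) =
      (A.map (algebraMap R S)).mulVec (algebraMap R S ∘ y) :=
    funext fun i => RingHom.map_mulVec _ A y i
  have hcomp : Function.Surjective fun x : Fin n → R => algebraMap R S ∘ x := hsurj.comp_left
  have hs : Function.Surjective (Fintype.linearCombination S w) ↔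
      Function.Surjective (Fintype.linearCombination R w) := by
    have h : (Fintype.linearCombination R w : (Fin n → R) → H) =
        Fintype.linearCombination S w ∘ fun x => algebraMap R S ∘ x :=
      funext fun x => (hlc x).symm
    rw [h]
    exact ⟨fun h => h.comp hcomp, Function.Surjective.of_comp⟩
  rw [hs]
  refine and_congr_right fun _ => ⟨fun h => le_antisymm ?_ ?_, fun h => le_antisymm ?_ ?_⟩
  · rintro _ ⟨y, rfl⟩
    rw [LinearMap.mem_ker, ← hlc, Matrix.mulVecLin_apply, hmap, ← LinearMap.mem_ker, ← h]
    exact ⟨_, rfl⟩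
  · -- Nakayama's lemma shows that the image of `A` contains `𝔪 ^ N Rⁿ`.
    have hle : LinearMap.ker (Fintype.linearCombination R w) ≤ LinearMap.range A.mulVecLin ⊔
        maximalIdeal R ^ (N + 1) • (⊤ : Submodule R (Fin n → R)) := by
      intro x hx
      rw [LinearMap.mem_ker, ← hlc, ← LinearMap.mem_ker, ← h] at hx
      obtain ⟨z, hz⟩ := hx
      obtain ⟨z, rfl⟩ := hcomp z
      refine Submodule.mem_sup.mpr ⟨A.mulVec z, ⟨z, rfl⟩, x - A.mulVec z, ?_,
        add_sub_cancel _ _⟩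
      rw [← hker, ← (Pi.basisFun R (Fin n)).sum_repr (x - A.mulVec z)]
      refine Submodule.sum_mem _ fun i _ => Submodule.smul_mem_smul (RingHom.mem_ker.mpr ?_) trivial
      have h1 := congrFun hz i
      simp only [Matrix.mulVecLin_apply, ← hmap, Function.comp_apply] at h1
      simp [h1]
    have hkill : maximalIdeal R ^ N • (⊤ : Submodule R (Fin n → R)) ≤
        LinearMap.ker (Fintype.linearCombination R w) :=
      Submodule.smul_le.mpr fun a ha x _ => by
        rw [LinearMap.mem_ker, map_smul]
        exact hN a ha _
    have hnak : maximalIdeal R ^ N • (⊤ : Submodule R (Fin n → R)) ≤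
        LinearMap.range A.mulVecLin := by
      refine Submodule.le_of_le_smul_of_le_jacobson_bot (I := maximalIdeal R)
        (IsNoetherian.noetherian _) (IsLocalRing.maximalIdeal_le_jacobson _) ?_
      rw [← Submodule.mul_smul, ← pow_succ']
      exact hkill.trans hle
    refine hle.trans (sup_le le_rfl (le_trans ?_ hnak))
    exact Submodule.smul_mono_left (Ideal.pow_le_pow_right N.le_succ)
  · rintro _ ⟨y, rfl⟩
    obtain ⟨y, rfl⟩ := hcomp y
    rw [LinearMap.mem_ker, Matrix.mulVecLin_apply, ← hmap, hlc, ← LinearMap.mem_ker, ← h]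
    exact ⟨y, rfl⟩
  · intro y hy
    obtain ⟨y, rfl⟩ := hcomp y
    rw [LinearMap.mem_ker, hlc, ← LinearMap.mem_ker, ← h] at hy
    obtain ⟨z, rfl⟩ := hy
    exact ⟨_, (hmap z).symm⟩

theorem Matrix.subsingleton_coker_iff {R : Type*} [CommRing R] {n : ℕ}
    (A : Matrix (Fin n) (Fin n) R) : Subsingleton A.coker ↔ IsUnit A := by
  rw [Matrix.coker, Submodule.Quotient.subsingleton_iff, LinearMap.range_eq_top,
    Matrix.coe_mulVecLin, Matrix.mulVec_surjective_iff_isUnit]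

theorem Matrix.map_aeval {R F : Type*} [CommRing R] [CommRing F] (f : R →+* F) {n : ℕ}
    (A : Matrix (Fin n) (Fin n) R) (p : R[X]) :
    (aeval A p).map f = aeval (A.map f) (p.map f) := by
  refine map_aeval_eq_aeval_map (φ := f) (ψ := f.mapMatrix) ?_ p A
  ext a i j
  by_cases h : i = j <;> simp [Matrix.algebraMap_matrix_apply, h]

/-! ### The limit distribution -/

theorem pairwise_isCoprime_of_monic_of_irreducible {F ι : Type*} [Field F]
    {p : ι → F[X]} (hm : ∀ j, (p j).Monic) (hp : ∀ j, Irreducible (p j))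
    (hinj : Function.Injective p) :
    Pairwise (Function.onFun IsCoprime p) := fun i j hij =>
  (hp i).coprime_iff_not_dvd.mpr fun h => hij (hinj
    (eq_of_monic_of_associated (hm i) (hm j) ((hp i).associated_of_dvd (hp j) h)))

section Field

variable {F : Type*} [Field F] [Finite F]

theorem card_coker_aeval_matrix {p : F[X]} (hp : Irreducible p) {n : ℕ}
    (Y : Matrix (Fin n) (Fin n) F) :
    Nat.card (aeval Y p).coker =
      (Nat.card F ^ p.natDegree) ^ primeCorank p (Module.AEval' (Matrix.toLin' Y)) := by
  rw [← card_coker_aeval hp]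
  have h : aeval (Matrix.toLin' Y) p = (aeval Y p).mulVecLin := by
    rw [← Matrix.toLin'_apply']
    exact aeval_algHom_apply (Matrix.toLinAlgEquiv' (R := F) (n := Fin n)) Y p
  rw [h]

theorem card_coker_aeval_eq_iff {p : F[X]} (hp : Irreducible p) {n : ℕ}
    (Y : Matrix (Fin n) (Fin n) F) (l : ℕ) :
    Nat.card (aeval Y p).coker = (Nat.card F ^ p.natDegree) ^ l ↔
      primeCorank p (Module.AEval' (Matrix.toLin' Y)) = l := by
  rw [card_coker_aeval_matrix hp]
  exact (Nat.pow_right_injective (Nat.one_lt_pow hp.natDegree_pos.ne' Finite.one_lt_card)).eq_iff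

theorem Matrix.isUnit_iff_card_coker {F : Type*} [Field F] {n : ℕ} (A : Matrix (Fin n) (Fin n) F) :
    IsUnit A ↔ Nat.card A.coker = 1 := by
  rw [← Matrix.subsingleton_coker_iff, Nat.card_eq_one_iff_unique]
  exact ⟨fun h => ⟨h, ⟨0⟩⟩, And.left⟩

/-- The proportion of matrices over a finite field with prescribed coranks at finitely many
irreducible polynomials. In the limit, different polynomials behave independently. -/
theorem tendsto_ncard_coker {r : ℕ} {p : Fin r → F[X]} (hp : ∀ j, Irreducible (p j))
    (hcop : Pairwise (Function.onFun IsCoprime p)) (l : Fin r → ℕ) :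
    Tendsto (fun n : ℕ => ({Y : Matrix (Fin n) (Fin n) F | ∀ j, Nat.card (aeval Y (p j)).coker =
        (Nat.card F ^ (p j).natDegree) ^ l j}.ncard : ℝ) /
          Nat.card (Matrix (Fin n) (Fin n) F)) atTop
      (𝓝 (∏ j, ∑' i, invCoeff ((Nat.card F : ℝ) ^ (p j).natDegree) (l j) i)) := by
  refine (tendsto_ncard_primeCorank hp hcop l).congr fun n => ?_
  rw [Nat.card_congr (Matrix.toLin' (R := F) (m := Fin n) (n := Fin n)).toEquiv,
    ← Set.ncard_image_of_injective _ (Matrix.toLin' (R := F) (m := Fin n) (n := Fin n)).injective]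
  congr 3
  ext T
  obtain ⟨Y, rfl⟩ := (Matrix.toLin' (R := F) (m := Fin n) (n := Fin n)).surjective T
  rw [(Matrix.toLin' (R := F) (m := Fin n) (n := Fin n)).injective.mem_set_image]
  exact forall_congr' fun j => (card_coker_aeval_eq_iff (hp j) Y (l j)).symm

theorem tendsto_ncard_card_coker_eq (d : ℕ) :
    Tendsto (fun n : ℕ => ({Y : Matrix (Fin n) (Fin n) F | Nat.card Y.coker =
        Nat.card F ^ d}.ncard : ℝ) / Nat.card (Matrix (Fin n) (Fin n) F)) atTop
      (𝓝 (∑' i, invCoeff (Nat.card F) d i)) := by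
  have h := tendsto_ncard_coker (F := F) (p := fun _ : Fin 1 => X) (fun _ => irreducible_X)
    (fun i j hij => (hij (Subsingleton.elim i j)).elim) fun _ => d
  simpa using h

end Field

section FiniteLevel

variable {S F : Type*} [CommRing S] [IsLocalRing S] [Finite S] [Field F] [Finite F] {ρ : S →+* F}
variable {H : Type*} [AddCommGroup H] [Module S H] [Finite H]

/-- The limit of the proportion of matrices `B` over a finite local principal ring such that
`B + a` has cokernel `H` and `p j` takes an invertible value at the reduction of `B` for every `j`
but the last one. -/
theorem tendsto_ncard_finite_level (hρ : Function.Surjective ρ) {π : S}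
    (hπ : maximalIdeal S = Ideal.span {π}) (hann : ∀ s : S, π * s = 0 → ∀ x : H, s • x = 0)
    (a : S) {r : ℕ} {p : Fin (r + 1) → F[X]} (hp : ∀ j, Irreducible (p j))
    (hcop : Pairwise (Function.onFun IsCoprime p)) (hlast : p (Fin.last r) = X + C (ρ a)) :
    Tendsto (fun n : ℕ => ({B : Matrix (Fin n) (Fin n) S |
        (∀ j : Fin r, IsUnit (aeval (B.map ρ) (p j.castSucc))) ∧
          Nonempty ((B + algebraMap S _ a).coker ≃ₗ[S] H)}.ncard : ℝ) /
        Nat.card (Matrix (Fin n) (Fin n) S)) atTop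
      (𝓝 ((Nat.card (H ≃ₗ[S] H) : ℝ)⁻¹ *
        ∏ j, ∏' i : ℕ, (1 - (((Nat.card F : ℝ) ^ (p j).natDegree) ^ (i + 1))⁻¹))) := by
  have hres : Nat.card (ResidueField S) = Nat.card F := natCard_residueField hρ
  obtain ⟨d, hd⟩ : ∃ d, Nat.card (H ⧸ maximalIdeal S • (⊤ : Submodule S H)) =
      Nat.card (ResidueField S) ^ d := by
    let : Field (S ⧸ maximalIdeal S) := Ideal.Quotient.field _
    have : Finite (H ⧸ maximalIdeal S • (⊤ : Submodule S H)) :=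
      Finite.of_surjective _ (Submodule.mkQ_surjective _)
    have : Module.Finite (S ⧸ maximalIdeal S) (H ⧸ maximalIdeal S • (⊤ : Submodule S H)) :=
      Module.Finite.of_finite
    exact ⟨_, Module.natCard_eq_pow_finrank (K := S ⧸ maximalIdeal S)⟩
  have hd' := hd
  rw [hres] at hd'
  have hq : (1 : ℝ) < Nat.card F := one_lt_natCast_card
  have hlastdeg : (p (Fin.last r)).natDegree = 1 := by rw [hlast, natDegree_X_add_C]
  have : Finite (H ≃ₗ[S] H) := Finite.of_injective _ DFunLike.coe_injective
  have hAut : (Nat.card (H ≃ₗ[S] H) : ℝ) ≠ 0 := by exact_mod_cast Nat.card_pos.ne'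
  let l : Fin (r + 1) → ℕ := Fin.snoc (fun _ => 0) d
  -- The conditions on the reduction of `B + a` that say that `p j` is invertible at that of `B`.
  let T (n : ℕ) : Set (Matrix (Fin n) (Fin n) F) :=
    {X | ∀ j : Fin r, IsUnit (aeval (X - algebraMap F _ (ρ a)) (p j.castSucc))}
  have hshift (n : ℕ) : {B : Matrix (Fin n) (Fin n) S |
        (∀ j : Fin r, IsUnit (aeval (B.map ρ) (p j.castSucc))) ∧
          Nonempty ((B + algebraMap S _ a).coker ≃ₗ[S] H)}.ncard =
      {A : Matrix (Fin n) (Fin n) S | Nonempty (A.coker ≃ₗ[S] H) ∧ A.map ρ ∈ T n}.ncard := by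
    rw [← Set.ncard_image_of_injective _
      (Equiv.addRight (algebraMap S (Matrix (Fin n) (Fin n) S) a)).injective]
    congr 1
    ext A
    obtain ⟨B, rfl⟩ := (Equiv.addRight (algebraMap S (Matrix (Fin n) (Fin n) S) a)).surjective A
    rw [(Equiv.addRight (algebraMap S (Matrix (Fin n) (Fin n) S) a)).injective.mem_set_image]
    have hB : (B + algebraMap S _ a).map ρ - algebraMap F _ (ρ a) = B.map ρ := by
      ext i j
      by_cases h : i = j <;> simp [Matrix.algebraMap_matrix_apply, h]
    simp only [T, Set.mem_ofPred_eq, Equiv.coe_addRight, hB]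
    exact and_comm
  have hfield (n : ℕ) : {X : Matrix (Fin n) (Fin n) F | X ∈ T n ∧
        Nat.card X.coker = Nat.card F ^ d}.ncard =
      {Y : Matrix (Fin n) (Fin n) F | ∀ j, Nat.card (aeval Y (p j)).coker =
        (Nat.card F ^ (p j).natDegree) ^ l j}.ncard := by
    symm
    rw [← Set.ncard_image_of_injective _
      (Equiv.addRight (algebraMap F (Matrix (Fin n) (Fin n) F) (ρ a))).injective]
    congr 1
    ext X
    obtain ⟨Y, rfl⟩ := (Equiv.addRight
      (algebraMap F (Matrix (Fin n) (Fin n) F) (ρ a))).surjective X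
    rw [(Equiv.addRight (algebraMap F (Matrix (Fin n) (Fin n) F) (ρ a))).injective.mem_set_image]
    simp only [T, l, Set.mem_ofPred_eq, Equiv.coe_addRight, add_sub_cancel_right,
      Fin.forall_fin_succ', Fin.snoc_castSucc, Fin.snoc_last, pow_zero,
      Matrix.isUnit_iff_card_coker, hlast, natDegree_X_add_C, pow_one, map_add, aeval_X, aeval_C]
  have h1 : Tendsto (fun n : ℕ => ({A : Matrix (Fin n) (Fin n) S |
        Nonempty (A.coker ≃ₗ[S] H)}.ncard : ℝ) / Nat.card (Matrix (Fin n) (Fin n) S)) atTop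
      (𝓝 ((Nat.card (H ≃ₗ[S] H) : ℝ)⁻¹ * ∏' i : ℕ, (1 - ((Nat.card F : ℝ) ^ (i + 1))⁻¹))) := by
    have h := ((tendsto_genDensity hq d).mul (tendsto_prod_one_sub_inv_pow hq)).const_mul
      (Nat.card (H ≃ₗ[S] H) : ℝ)⁻¹
    rw [one_mul] at h
    refine h.congr fun n => ?_
    have hn := ncard_coker_mul_card_aut hπ hann hd n
    have h0 : (Nat.card (Matrix (Fin n) (Fin n) S) : ℝ) ≠ 0 := by exact_mod_cast Nat.card_pos.ne'
    rw [hres, genDensity_self hq] at hn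
    rw [eq_div_iff h0, inv_mul_eq_div, div_mul_eq_mul_div, div_eq_iff hAut, hn, mul_comm]
  have h2 := tendsto_ncard_coker hp hcop l
  have h3 := tendsto_ncard_card_coker_eq (F := F) d
  have h30 : ∑' i, invCoeff (Nat.card F) d i ≠ 0 := tsum_invCoeff_ne_zero hq d
  have hlim := (h1.mul h2).div h3 h30
  have hvalue : (Nat.card (H ≃ₗ[S] H) : ℝ)⁻¹ * (∏' i : ℕ, (1 - ((Nat.card F : ℝ) ^ (i + 1))⁻¹)) *
        (∏ j, ∑' i, invCoeff ((Nat.card F : ℝ) ^ (p j).natDegree) (l j) i) /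
        ∑' i, invCoeff (Nat.card F) d i =
      (Nat.card (H ≃ₗ[S] H) : ℝ)⁻¹ *
        ∏ j, ∏' i : ℕ, (1 - (((Nat.card F : ℝ) ^ (p j).natDegree) ^ (i + 1))⁻¹) := by
    rw [Fin.prod_univ_castSucc, Fin.prod_univ_castSucc, hlastdeg, pow_one]
    simp only [l, Fin.snoc_castSucc, Fin.snoc_last]
    rw [Finset.prod_congr rfl fun j _ => tsum_invCoeff_zero (one_lt_card_pow_natDegree (hp _))]
    field_simp
  rw [hvalue] at hlim
  refine hlim.congr' ?_
  -- The limit proportion of corank `d` is not zero, so for large `n` one can divide by it.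
  filter_upwards [h3.eventually_ne h30] with n hn
  have hmul := ncard_coker_inter_mul (H := H) hρ hd' (T n)
  rw [hfield, ← hshift] at hmul
  have hmul' : (_ : ℝ) = _ := congrArg Nat.cast hmul
  push_cast at hmul'
  have hn' := (div_ne_zero_iff.mp hn)
  have hS0 : (Nat.card (Matrix (Fin n) (Fin n) S) : ℝ) ≠ 0 := by exact_mod_cast Nat.card_pos.ne'
  obtain ⟨hR0, hF0⟩ := hn'
  simp only [Pi.div_apply]
  field_simp
  linear_combination -hmul'

end FiniteLevel

theorem theoremC {R : Type*} [CommRing R] [IsDomain R] [IsDiscreteValuationRing R]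
    [IsAdicComplete (maximalIdeal R) R] [Finite (ResidueField R)]
    (q : ℕ) (hq : Nat.card (ResidueField R) = q)
    (r : ℕ) (P : Fin (r + 1) → R[X])
    (hmonic : ∀ j, (P j).Monic)
    (hirr : ∀ j, Irreducible ((P j).map (residue R)))
    (hdist : Function.Injective fun j => (P j).map (residue R))
    (hdeg : (P (Fin.last r)).natDegree = 1)
    (H : Type*) [AddCommGroup H] [Module R H] (hH : IsFiniteLength R H) :
    (∀ n, MeasurableSet[matrixBorel R n] (cokerEvent P H n)) ∧
    Finite (H ≃ₗ[R] H) ∧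
    (∀ j, Multipliable fun i : ℕ => 1 - ((q : ℝ) ^ ((i + 1) * (P j).natDegree))⁻¹) ∧
    Tendsto (fun n => (haarMatrix R n (cokerEvent P H n)).toReal) atTop
      (𝓝 ((Nat.card (H ≃ₗ[R] H) : ℝ)⁻¹ *
        ∏ j, ∏' i : ℕ, (1 - ((q : ℝ) ^ ((i + 1) * (P j).natDegree))⁻¹))) := by
  obtain ⟨hfin, N, hN⟩ := hH.finite_and_exists_pow_smul_eq_zero
  have hAut : Finite (H ≃ₗ[R] H) := Finite.of_injective _ DFunLike.coe_injective
  have hdegmap (j : Fin (r + 1)) : ((P j).map (residue R)).natDegree = (P j).natDegree :=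
    (hmonic j).natDegree_map _
  have hpow (j : Fin (r + 1)) (i : ℕ) : (q : ℝ) ^ ((i + 1) * (P j).natDegree) =
      ((Nat.card (ResidueField R) : ℝ) ^ ((P j).map (residue R)).natDegree) ^ (i + 1) := by
    rw [hq, hdegmap, ← pow_mul, mul_comm]
  -- The event is decided modulo `I`. The additional factor of the maximal ideal beyond the `N`
  -- that kill `H` is what lets Nakayama's lemma apply, and makes `ϖ`-torsion in `R ⧸ I` kill `H`.
  let I : Ideal R := maximalIdeal R ^ (N + 1)
  have hI : I ≤ maximalIdeal R := Ideal.pow_le_self N.succ_ne_zero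
  have : Nontrivial (R ⧸ I) := Ideal.Quotient.nontrivial_iff.mpr fun h =>
    (Ideal.IsPrime.ne_top inferInstance : maximalIdeal R ≠ ⊤) (top_le_iff.mp (h ▸ hI))
  have : IsLocalRing (R ⧸ I) := IsLocalRing.of_surjective' _ Ideal.Quotient.mk_surjective
  have : Finite (R ⧸ maximalIdeal R) := inferInstanceAs (Finite (ResidueField R))
  have : Finite (R ⧸ I) :=
    Ideal.finite_quotient_pow (IsNoetherian.noetherian (maximalIdeal R)) (N + 1)
  have htors : Module.IsTorsionBySet R H I := fun x a =>
    hN a (Ideal.pow_le_pow_right N.le_succ a.2) x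
  let : Module (R ⧸ I) H := htors.module
  have : IsScalarTower R (R ⧸ I) H := htors.isScalarTower
  let ρ : (R ⧸ I) →+* ResidueField R := Ideal.Quotient.factor hI
  have hρ : Function.Surjective ρ := Ideal.Quotient.factor_surjective hI
  have hρmk (x : R) : ρ (Ideal.Quotient.mk I x) = residue R x := rfl
  obtain ⟨ϖ, hϖ⟩ := IsDiscreteValuationRing.exists_irreducible R
  have hmax : maximalIdeal (R ⧸ I) = Ideal.span {Ideal.Quotient.mk I ϖ} := by
    rw [← ker_eq_maximalIdeal hρ, ← Set.image_singleton, ← Ideal.map_span, ← hϖ.maximalIdeal_eq]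
    ext x
    obtain ⟨x, rfl⟩ := Ideal.Quotient.mk_surjective x
    rw [RingHom.mem_ker, hρmk, IsLocalRing.residue_eq_zero_iff, Ideal.mem_quotient_iff_mem hI]
  have hann (s : R ⧸ I) (hs : Ideal.Quotient.mk I ϖ * s = 0) (x : H) : s • x = 0 := by
    obtain ⟨s, rfl⟩ := Ideal.Quotient.mk_surjective s
    rw [← map_mul, Ideal.Quotient.eq_zero_iff_mem] at hs
    refine hN s ?_ x
    simp only [I, hϖ.maximalIdeal_eq, Ideal.span_singleton_pow, Ideal.mem_span_singleton] at hs ⊢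
    rw [pow_succ'] at hs
    exact (mul_dvd_mul_iff_left hϖ.ne_zero).mp hs
  set a := (P (Fin.last r)).coeff 0
  have hP : P (Fin.last r) = X + C a := (hmonic _).eq_X_add_C hdeg
  have hlast : (P (Fin.last r)).map (residue R) = X + C (ρ (Ideal.Quotient.mk I a)) := by
    rw [hP, Polynomial.map_add, map_X, map_C, hρmk]
  have hcop := pairwise_isCoprime_of_monic_of_irreducible
    (fun j => (hmonic j).map (residue R)) hirr hdist
  let T (n : ℕ) : Set (Matrix (Fin n) (Fin n) (R ⧸ I)) :=
    {B | (∀ j : Fin r, IsUnit (aeval (B.map ρ) ((P j.castSucc).map (residue R)))) ∧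
      Nonempty ((B + algebraMap (R ⧸ I) _ (Ideal.Quotient.mk I a)).coker ≃ₗ[R ⧸ I] H)}
  have hevent (n : ℕ) : cokerEvent P H n =
      (fun A : Matrix (Fin n) (Fin n) R => A.map (Ideal.Quotient.mk I)) ⁻¹' T n := by
    ext A
    refine and_congr (forall_congr' fun j => ?_) ?_
    · rw [Matrix.subsingleton_coker_iff, ← Matrix.isUnit_map_iff IsLocalRing.residue_surjective,
        Matrix.map_aeval]
      rfl
    · rw [hP, map_add, aeval_X, aeval_C,
        ← nonempty_coker_map_linearEquiv_iff (S := R ⧸ I) Ideal.Quotient.mk_surjective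
          Ideal.mk_ker hN]
      have h : (A + algebraMap R _ a).map (algebraMap R (R ⧸ I)) =
          A.map (Ideal.Quotient.mk I) + algebraMap (R ⧸ I) _ (Ideal.Quotient.mk I a) := by
        ext i j
        by_cases h : i = j <;> simp [Matrix.algebraMap_matrix_apply, h]
      rw [h]
  have hcardAut : Nat.card (H ≃ₗ[R ⧸ I] H) = Nat.card (H ≃ₗ[R] H) :=
    Nat.card_congr
      { toFun := fun e => e.restrictScalars R
        invFun := fun e => e.extendScalarsOfSurjective Ideal.Quotient.mk_surjective
        left_inv := fun e => rfl
        right_inv := fun e => rfl }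
  refine ⟨fun n => ?_, hAut, fun j => ?_, ?_⟩
  · rw [hevent]
    exact (haarMatrix_preimage n (N + 1) (T n)).1
  · simp_rw [hpow]
    exact multipliable_one_sub_inv_pow (one_lt_card_pow_natDegree (hirr j))
  · have h := tendsto_ncard_finite_level hρ hmax hann (Ideal.Quotient.mk I a) hirr hcop hlast
    rw [hcardAut] at h
    simp_rw [hpow]
    refine h.congr fun n => ?_
    rw [hevent]
    exact (haarMatrix_preimage n (N + 1) (T n)).2.symm
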